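/- All rings are commutative with unit. A \emph{pair} $(A,I)$ is a ring with an ideal; a morphism of pairs $(A,I)\to(B,J)$ is a ring homomorphism $\varphi$ with $\varphi^{-1}(J)=I$. A pair $(A,I)$ is \emph{henselian} if $I$ lies in the Jacobson radical of $A$ and every étale $A$-algebra $B$ for which $A/I\to B\otimes_A A/I$ is an isomorphism admits an $A$-homomorphism $B\to A$. The \emph{henselization} of a pair is the universal morphism from it to a henselian pair. A ring $A$ has \emph{bounded $I$-torsion} if there is $l>0$ such that $I^l$ annihilates every $x\in A$ that is killed by some power of each $a\in I$. A finite sequence $a_1,\dots,a_r$ in $A$ is \emph{weakly proregular} if for all $k>0$ and $n>0$ there is $m>n$ such that the natural map of Koszul homology $H_k(a_1^m,\dots,a_r^m)\to H_k(a_1^n,\dots,a_r^n)$ (induced by the maps $K(a_i^m)\to K(a_i^n)$ that are the identity in degree $0$ and multiplication by $a_i^{m-n}$ in degree $1$) is zero; an ideal is weakly proregular if it is generated by some weakly proregular finite sequence. \textbf{Claim.} Let $k$ be a field, let $$R=k[x_0,x_1,x_2,\dots][y]/(x_0y,\ x_0-x_1y,\ x_1-x_2y,\ x_2-x_3y,\dots),$$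 and let $$A'_0=R[t,u]/(\mathfrak n+\mathfrak n'),\qquad \mathfrak n=(x_0t^2,x_1t^3,x_2t^4,\dots),\quad \mathfrak n'=(x_0u,x_1tu,x_2t^2u,\dots),\qquad I_0=(t,u)A'_0 .$$ Then the pair $(A'_0,I_0)$ has a henselization; and if $A'$ is the $I_0$-adic henselization of $A'_0$ and $I=I_0A'$, then $A'$ has bounded $I$-torsion, but the ideal $I$ is not weakly proregular. -/

import Mathlib

open CategoryTheory
open scoped TensorProduct

universe u

noncomputable section

/-! ### Koszul complexes and weak proregularity -/

namespace Koszul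

section Contraction

variable {A : Type u} [CommRing A] {M N : Type u} [AddCommGroup M] [Module A M]
  [AddCommGroup N] [Module A N]

theorem contractLeft_mem (φ : Module.Dual A M) (k : ℕ) :
    ∀ x ∈ ⋀[A]^(k + 1) M,
      CliffordAlgebra.contractLeft (Q := (0 : QuadraticForm A M)) φ x ∈ ⋀[A]^k M := by
  induction k with
  | zero =>
    intro x hx
    rw [zero_add, ExteriorAlgebra.exteriorPower, pow_one] at hx
    obtain ⟨v, rfl⟩ := hx
    have h := CliffordAlgebra.contractLeft_ι (Q := (0 : QuadraticForm A M)) (d := φ) v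
    rw [ExteriorAlgebra.exteriorPower, pow_zero, Submodule.mem_one]
    exact ⟨φ v, h.symm⟩
  | succ k ih =>
    intro x hx
    rw [ExteriorAlgebra.exteriorPower, pow_succ'] at hx
    refine Submodule.mul_induction_on hx ?_ ?_
    · rintro _ ⟨v, rfl⟩ n hn
      have h := CliffordAlgebra.contractLeft_ι_mul (Q := (0 : QuadraticForm A M)) (d := φ) v n
      erw [h]
      refine Submodule.sub_mem _ (Submodule.smul_mem _ _ hn) ?_
      rw [ExteriorAlgebra.exteriorPower, pow_succ']
      exact Submodule.mul_mem_mul ⟨v, rfl⟩ (ih n hn)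
    · intro x y hx hy
      rw [map_add]
      exact Submodule.add_mem _ hx hy

/-- The contraction `⋀^(k+1) M → ⋀^k M` by a linear form `φ`, that is
`v₀ ∧ ⋯ ∧ v_k ↦ ∑ (-1)^i φ(v_i) v₀ ∧ ⋯ v̂_i ⋯ ∧ v_k`. -/
def contraction (φ : Module.Dual A M) (k : ℕ) : ⋀[A]^(k + 1) M →ₗ[A] ⋀[A]^k M :=
  (CliffordAlgebra.contractLeft (Q := (0 : QuadraticForm A M)) φ).restrict (contractLeft_mem φ k)

theorem contraction_contraction (φ : Module.Dual A M) (k : ℕ) :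
    contraction φ k ∘ₗ contraction φ (k + 1) = 0 := by
  ext1
  ext v
  exact CliffordAlgebra.contractLeft_contractLeft (Q := (0 : QuadraticForm A M)) (d := φ) _

theorem map_contractLeft (f : M →ₗ[A] N) (φ : Module.Dual A M) (ψ : Module.Dual A N)
    (h : ψ ∘ₗ f = φ) (x : ExteriorAlgebra A M) :
    ExteriorAlgebra.map f (CliffordAlgebra.contractLeft (Q := (0 : QuadraticForm A M)) φ x) =
      CliffordAlgebra.contractLeft (Q := (0 : QuadraticForm A N)) ψ (ExteriorAlgebra.map f x) := by
  subst h
  induction x using CliffordAlgebra.left_induction with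
  | algebraMap r =>
    rw [CliffordAlgebra.contractLeft_algebraMap, map_zero, AlgHom.commutes]
    exact (CliffordAlgebra.contractLeft_algebraMap (Q := (0 : QuadraticForm A N)) (d := _) r).symm
  | add x y hx hy => simp only [map_add, hx, hy]
  | ι_mul x m hx =>
    have e : ExteriorAlgebra.map f (CliffordAlgebra.ι (0 : QuadraticForm A M) m) =
      CliffordAlgebra.ι (0 : QuadraticForm A N) (f m) := ExteriorAlgebra.map_apply_ι f m
    rw [CliffordAlgebra.contractLeft_ι_mul, map_sub, map_smul, map_mul, map_mul, hx, e]
    exact (CliffordAlgebra.contractLeft_ι_mul (Q := (0 : QuadraticForm A N)) (d := ψ) (f m) _).symm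

theorem coe_map (f : M →ₗ[A] N) (k : ℕ) (x : ⋀[A]^k M) :
    (exteriorPower.map k f x : ExteriorAlgebra A N) = ExteriorAlgebra.map f x := by
  have : (⋀[A]^k N).subtype ∘ₗ exteriorPower.map k f =
      (ExteriorAlgebra.map f).toLinearMap ∘ₗ (⋀[A]^k M).subtype := by
    ext1
    ext v
    simp [ExteriorAlgebra.map_apply_ιMulti]
  exact LinearMap.congr_fun this x

theorem map_contraction (f : M →ₗ[A] N) (φ : Module.Dual A M) (ψ : Module.Dual A N)
    (h : ψ ∘ₗ f = φ) (k : ℕ) :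
    exteriorPower.map k f ∘ₗ contraction φ k =
      contraction ψ k ∘ₗ exteriorPower.map (k + 1) f := by
  refine LinearMap.ext fun x => Subtype.ext ?_
  rw [LinearMap.comp_apply, LinearMap.comp_apply, coe_map]
  refine (map_contractLeft f φ ψ h x).trans ?_
  rw [← coe_map]
  rfl

end Contraction

variable {A : Type u} [CommRing A] {r : ℕ}

/-- The Koszul complex `K(a₁, …, a_r)`: it is `⋀^k (A^r)` in degree `k`, with differential the
contraction by the linear form `A^r → A`, `e_i ↦ a_i`. -/
def complex (a : Fin r → A) : ChainComplex (ModuleCat.{u} A) ℕ :=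
  ChainComplex.of (fun k => ModuleCat.of A (⋀[A]^k (Fin r → A)))
    (fun k => ModuleCat.ofHom (contraction (Fintype.linearCombination A a) k))
    (fun k => by
      rw [← ModuleCat.ofHom_comp, contraction_contraction]
      rfl)

/-- The diagonal map `A^r → A^r`, `e_i ↦ a_i^d e_i`. -/
def diagonalPow (a : Fin r → A) (d : ℕ) : (Fin r → A) →ₗ[A] (Fin r → A) :=
  LinearMap.pi fun i => (a i ^ d) • LinearMap.proj i

theorem linearCombination_comp_diagonalPow (a : Fin r → A) {n m : ℕ} (h : n ≤ m) :
    Fintype.linearCombination A (fun i => a i ^ n) ∘ₗ diagonalPow a (m - n) =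
      Fintype.linearCombination A (fun i => a i ^ m) := by
  ext1 i
  ext
  simp only [LinearMap.comp_apply, Fintype.linearCombination_apply, diagonalPow,
    LinearMap.pi_apply, LinearMap.smul_apply, LinearMap.proj_apply, smul_eq_mul]
  refine Finset.sum_congr rfl fun j _ => ?_
  rw [← pow_sub_mul_pow (a j) h]
  ring

/-- The transition morphism `K(a₁^m, …, a_r^m) → K(a₁^n, …, a_r^n)` for `n ≤ m`: in degree `1` it
is `e_i ↦ a_i^(m-n) e_i`, and in degree `k` it is the `k`-th exterior power of this map. It is the
tensor product of the morphisms `K(a_i^m) → K(a_i^n)` given by `1` in degree `0` and by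
`a_i^(m-n)` in degree `1`. -/
def transition (a : Fin r → A) {n m : ℕ} (h : n ≤ m) :
    complex (fun i => a i ^ m) ⟶ complex (fun i => a i ^ n) :=
  ChainComplex.ofHom
    (fun k => ModuleCat.ofHom (exteriorPower.map k (diagonalPow a (m - n))))
    (fun k => by
      simp only [complex, ChainComplex.of_d]
      rw [← ModuleCat.ofHom_comp, ← ModuleCat.ofHom_comp,
        map_contraction _ _ _ (linearCombination_comp_diagonalPow a h)])

end Koszul

/-- A finite sequence `a` is weakly proregular if for every `k > 0` the inverse system
`H_k(a₁^i, …, a_r^i)`, `i > 0`, of Koszul homology modules is pro-zero. -/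
def IsWeaklyProregularSeq {A : Type u} [CommRing A] {r : ℕ} (a : Fin r → A) : Prop :=
  ∀ k : ℕ, 0 < k → ∀ n : ℕ, 0 < n → ∃ (m : ℕ) (h : n < m),
    HomologicalComplex.homologyMap (Koszul.transition a h.le) k = 0

/-- An ideal is weakly proregular if it is generated by a weakly proregular finite sequence. -/
def Ideal.IsWeaklyProregular {A : Type u} [CommRing A] (I : Ideal A) : Prop :=
  ∃ (r : ℕ) (a : Fin r → A), Ideal.span (Set.range a) = I ∧ IsWeaklyProregularSeq a

/-! ### Bounded torsion -/

/-- The ideal of `I`-torsion elements: those `x` such that every `a ∈ I` has a power killing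
`x`. -/
def Ideal.torsionElements {A : Type u} [CommRing A] (I : Ideal A) : Ideal A :=
  ⨅ a ∈ I, Submodule.torsion' A A (Submonoid.powers a)

/-- `A` has bounded `I`-torsion if some power `I^l`, `l > 0`, kills all `I`-torsion elements. -/
def Ideal.HasBoundedTorsion {A : Type u} [CommRing A] (I : Ideal A) : Prop :=
  ∃ l : ℕ, 0 < l ∧ I ^ l * I.torsionElements = ⊥

/-! ### Henselian pairs and henselization -/

/-- `(A, I)` is a henselian pair: `I` lies in the Jacobson radical of `A`, and every étale
`A`-algebra `B` such that `A/I → B ⊗ A/I` is an isomorphism admits an `A`-homomorphism `B → A`. -/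
structure IsHenselianPair {A : Type u} [CommRing A] (I : Ideal A) : Prop where
  le_jacobson : I ≤ Ring.jacobson A
  exists_section : ∀ (B : Type u) [CommRing B] [Algebra A B] [Algebra.Etale A B],
    Function.Bijective (Algebra.TensorProduct.includeRight : (A ⧸ I) →ₐ[A] B ⊗[A] (A ⧸ I)) →
      Nonempty (B →ₐ[A] A)

/-- A ring homomorphism `φ` is a morphism of pairs `(A, I) → (B, J)` if `φ⁻¹(J) = I`. -/
def IsPairMorphism {A B : Type u} [CommRing A] [CommRing B] (I : Ideal A) (J : Ideal B)
    (φ : A →+* B) : Prop :=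
  J.comap φ = I

/-- `φ : (A, I) → (H, J)` is a henselization of `(A, I)`: it is a morphism of pairs to a henselian
pair, and every morphism of pairs from `(A, I)` to a henselian pair factors uniquely through it. -/
structure IsHenselization {A H : Type u} [CommRing A] [CommRing H] (I : Ideal A) (J : Ideal H)
    (φ : A →+* H) : Prop where
  isHenselianPair : IsHenselianPair J
  isPairMorphism : IsPairMorphism I J φ
  existsUnique_lift : ∀ (B : Type u) [CommRing B] (K : Ideal B), IsHenselianPair K →
    ∀ ψ : A →+* B, IsPairMorphism I K ψ →
      ∃! ψ' : H →+* B, IsPairMorphism J K ψ' ∧ ψ'.comp φ = ψ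

/-! ### The example -/

namespace Example

variable (k : Type u) [Field k]

/-- The ideal `(x₀y, x₀ - x₁y, x₁ - x₂y, …)` of `k[x₀, x₁, …][y]`. -/
def idealR : Ideal (Polynomial (MvPolynomial ℕ k)) :=
  Ideal.span ({Polynomial.C (MvPolynomial.X 0) * Polynomial.X} ∪
    Set.range fun i : ℕ => Polynomial.C (MvPolynomial.X i) -
      Polynomial.C (MvPolynomial.X (i + 1)) * Polynomial.X)

/-- `R = k[x₀, x₁, …][y] / (x₀y, x₀ - x₁y, x₁ - x₂y, …)`. -/
def R : Type u := Polynomial (MvPolynomial ℕ k) ⧸ idealR k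

instance : CommRing (R k) := inferInstanceAs (CommRing (Polynomial (MvPolynomial ℕ k) ⧸ idealR k))

/-- The class of `x_i` in `R`. -/
def x (i : ℕ) : R k := Ideal.Quotient.mk (idealR k) (Polynomial.C (MvPolynomial.X i))

/-- The polynomial ring `R[t, u]`, where `t` and `u` are the variables number `0` and `1`. -/
abbrev Rtu : Type u := MvPolynomial (Fin 2) (R k)

/-- The ideal `(x₀t², x₁t³, x₂t⁴, …)` of `R[t, u]`. -/
def idealN : Ideal (Rtu k) :=
  Ideal.span (Set.range fun i : ℕ => MvPolynomial.C (x k i) * MvPolynomial.X 0 ^ (i + 2))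

/-- The ideal `(x₀u, x₁tu, x₂t²u, …)` of `R[t, u]`. -/
def idealN' : Ideal (Rtu k) :=
  Ideal.span (Set.range fun i : ℕ =>
    MvPolynomial.C (x k i) * MvPolynomial.X 0 ^ i * MvPolynomial.X 1)

/-- `A'₀ = R[t, u] / ((x₀t², x₁t³, …) + (x₀u, x₁tu, …))`. -/
abbrev A₀ : Type u := Rtu k ⧸ (idealN k ⊔ idealN' k)

/-- The class of `t` in `A'₀`. -/
def t : A₀ k := Ideal.Quotient.mk _ (MvPolynomial.X 0)

/-- The class of `u` in `A'₀`. -/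
def u : A₀ k := Ideal.Quotient.mk _ (MvPolynomial.X 1)

/-- The ideal `I₀ = (t, u)` of `A'₀`. -/
def I₀ : Ideal (A₀ k) := Ideal.span {t k, u k}

end Example

end

noncomputable section

/-! ### Étale neighbourhoods -/

/-! Existence. The henselization of `(A, I)` is the filtered colimit of its étale neighbourhoods,
the étale algebras `B` with `A/I = B/IB`. The main tool is rigidity: two `A`-maps out of `B` agree
modulo `I`, so by unramifiedness their differences lie in an ideal generated by an idempotent from
the extension of `I`. That idempotent dies after inverting `1 - e`, which makes the diagram
filtered, and is already zero when `I` lands in the Jacobson radical, which gives uniqueness in the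
universal property. The colimit is henselian because an étale algebra over it comes from a finite
stage (`Henselization.isHenselianPair`).

Bounded torsion. Each `x_i` is divisible by every power of `y` and killed by some power of `y`, so
`x_i x_j = 0`. Hence `A'₀` embeds in `k[y, t, u] ⊕ M` with `M² = 0`, where `x_i t^a u^b` becomes the
class of `y^(-i-1) t^a u^b` in a monomial quotient `M` of a Laurent ring (`toModel_injective`).
Vanishing in `M` is an inequality between exponents, and it shows that all `u`-power torsion is
killed by `u` and `t²`. Annihilators of elements commute with flat base change, so this survives in
`A'`, where `I²` therefore kills the torsion.

Failure of weak proregularity. Vanishing of a transition map on `H₁` would give a fixed `M` such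
that `t^(M+1) f = 0` forces `t^M f ∈ (u)` (`Ideal.IsWeaklyProregular.exists_pow_mul_mem`). With `M =
i + 1` and `f = x_i` the hypothesis holds, but `t^(i+1) x_i` is not even in `(u, t^(i+2))`. This
persists in `A'`: in the quotient by `(u, t^(i+2))` the image of `I₀` is nilpotent, so the quotient
is a henselian pair and the projection from `A'₀` factors through `A'`. -/

theorem eq_zero_of_isIdempotentElem_of_mem_jacobson {A : Type*} [CommRing A] {e : A}
    (he : IsIdempotentElem e) (hj : e ∈ Ring.jacobson A) : e = 0 := by
  rw [← Ideal.jacobson_bot, Ideal.mem_jacobson_bot] at hj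
  have h := hj (-1)
  refine h.mul_left_eq_zero.mp ?_
  linear_combination -he.eq

/-- Two homomorphisms from an unramified algebra that agree modulo `K` become equal after an
idempotent of `K` is killed. -/
theorem Algebra.FormallyUnramified.exists_idempotent_sub_mem {A B C : Type*} [CommRing A]
    [CommRing B] [CommRing C] [Algebra A B] [Algebra A C] [Algebra.FormallyUnramified A C]
    [Algebra.FiniteType A C] (K : Ideal B) (f g : C →ₐ[A] B) (h : ∀ c, f c - g c ∈ K) :
    ∃ e ∈ K, IsIdempotentElem e ∧ ∀ c, f c - g c ∈ Ideal.span {e} := by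
  -- Unramified means `J/J² = 0` for the diagonal ideal `J` of `C ⊗ C`. Being finitely generated,
  -- `J` is generated by an idempotent, and the required one is its image under `c ⊗ d ↦ f(c) g(d)`.
  have hi : IsIdempotentElem (KaehlerDifferential.ideal A C) :=
    (Ideal.cotangent_subsingleton_iff _).mp (inferInstanceAs (Subsingleton Ω[C⁄A]))
  obtain ⟨e, he, heq⟩ :=
    (Ideal.isIdempotentElem_iff_of_fg _ (KaehlerDifferential.ideal_fg A C)).mp hi
  let p : C ⊗[A] C →ₐ[A] B := Algebra.TensorProduct.lift f g fun _ _ => Commute.all _ _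
  have hp : ∀ c d, p (c ⊗ₜ d) = f c * g d := fun c d => Algebra.TensorProduct.lift_tmul _ _ _ _ _
  have hle : KaehlerDifferential.ideal A C ≤ K.comap p := by
    rw [← KaehlerDifferential.span_range_eq_ideal, Ideal.span_le]
    rintro _ ⟨c, rfl⟩
    simp only [SetLike.mem_coe, Ideal.mem_comap, map_sub, hp, map_one, one_mul, mul_one]
    rw [← neg_sub]
    exact neg_mem (h c)
  refine ⟨p e, hle ?_, he.map p, fun c => ?_⟩
  · rw [heq]
    exact Submodule.mem_span_singleton_self e
  · have hc : c ⊗ₜ[A] (1 : C) - (1 : C) ⊗ₜ[A] c ∈ KaehlerDifferential.ideal A C := by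
      rw [← neg_sub]
      exact neg_mem (KaehlerDifferential.one_smul_sub_smul_one_mem_ideal A c)
    rw [heq] at hc
    obtain ⟨d, hd⟩ := Ideal.mem_span_singleton'.mp hc
    rw [Ideal.mem_span_singleton']
    refine ⟨p d, ?_⟩
    rw [← map_mul, hd, map_sub, hp, hp, map_one, map_one, one_mul, mul_one]

section EtaleNbhd

variable {A : Type u} [CommRing A]

/-- An étale neighbourhood of `(A, I)`: an étale `A`-algebra `B` with `A/I ≅ B/IB`. -/
structure IsEtaleNbhd (I : Ideal A) (B : Type u) [CommRing B] [Algebra A B] : Prop where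
  etale : Algebra.Etale A B
  exists_ker_eq : ∃ π : B →ₐ[A] A ⧸ I, RingHom.ker π = I.map (algebraMap A B)

variable {I : Ideal A} {B : Type u} [CommRing B] [Algebra A B]

theorem AlgHom.apply_mem_map_algebraMap {C : Type*} [CommRing C] [Algebra A C] (f : B →ₐ[A] C)
    {b : B} (hb : b ∈ I.map (algebraMap A B)) : f b ∈ I.map (algebraMap A C) := by
  rw [← f.comp_algebraMap, ← Ideal.map_map]
  exact Ideal.mem_map_of_mem f.toRingHom hb

theorem AlgHom.quotient_surjective (π : B →ₐ[A] A ⧸ I) : Function.Surjective π := by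
  intro z
  obtain ⟨a, rfl⟩ := Ideal.Quotient.mk_surjective z
  exact ⟨algebraMap A B a, π.commutes a⟩

theorem AlgHom.map_le_ker_quotient (π : B →ₐ[A] A ⧸ I) :
    I.map (algebraMap A B) ≤ RingHom.ker π := by
  rw [Ideal.map_le_iff_le_comap]
  intro i hi
  rw [Ideal.mem_comap, RingHom.mem_ker, π.commutes]
  exact Ideal.Quotient.eq_zero_iff_mem.mpr hi

namespace IsEtaleNbhd

theorem exists_sub_mem (h : IsEtaleNbhd I B) (b : B) :
    ∃ a : A, b - algebraMap A B a ∈ I.map (algebraMap A B) := by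
  obtain ⟨π, hπ⟩ := h.exists_ker_eq
  obtain ⟨a, ha⟩ := Ideal.Quotient.mk_surjective (π b)
  refine ⟨a, ?_⟩
  rw [← hπ, RingHom.mem_ker, map_sub, π.commutes, ← ha]
  exact sub_self _

/-- If `b ≡ a` modulo `IB` and `π b = 0`, then `a ∈ I`, so `b ∈ IB`. This reduces later
verifications to surjectivity of `A → B/IB`. -/
theorem of_exists_sub_mem [Algebra.Etale A B] (π : B →ₐ[A] A ⧸ I)
    (h : ∀ b : B, ∃ a : A, b - algebraMap A B a ∈ I.map (algebraMap A B)) : IsEtaleNbhd I B := by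
  refine ⟨inferInstance, π, le_antisymm (fun b hb => ?_) π.map_le_ker_quotient⟩
  obtain ⟨a, ha⟩ := h b
  have h1 := π.map_le_ker_quotient ha
  rw [RingHom.mem_ker] at hb h1
  rw [map_sub, hb, zero_sub, neg_eq_zero, π.commutes] at h1
  have h2 : a ∈ I := Ideal.Quotient.eq_zero_iff_mem.mp h1
  simpa using add_mem ha (Ideal.mem_map_of_mem (algebraMap A B) h2)

/-- Homomorphisms of `A`-algebras out of an étale neighbourhood of `(A, I)` agree modulo any
ideal containing the image of `I`. -/
theorem sub_mem (h : IsEtaleNbhd I B) {C : Type*} [CommRing C] [Algebra A C] {K : Ideal C}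
    (hK : I.map (algebraMap A C) ≤ K) (f g : B →ₐ[A] C) (b : B) : f b - g b ∈ K := by
  obtain ⟨a, ha⟩ := h.exists_sub_mem b
  have key : ∀ f : B →ₐ[A] C, f b - algebraMap A C a ∈ K := by
    intro f
    rw [← f.commutes, ← map_sub]
    exact hK (f.apply_mem_map_algebraMap ha)
  simpa using Ideal.sub_mem _ (key f) (key g)

/-- The idempotent measuring the difference lies in the Jacobson radical, hence is zero. -/
theorem algHom_ext (h : IsEtaleNbhd I B) {C : Type*} [CommRing C] [Algebra A C] {K : Ideal C}
    (hK : I.map (algebraMap A C) ≤ K) (hj : K ≤ Ring.jacobson C) (f g : B →ₐ[A] C) : f = g := by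
  have := h.etale
  obtain ⟨e, heK, he, hfg⟩ :=
    Algebra.FormallyUnramified.exists_idempotent_sub_mem K f g (h.sub_mem hK f g)
  ext b
  have := hfg b
  rw [eq_zero_of_isIdempotentElem_of_mem_jacobson he (hj heK)] at this
  simpa [sub_eq_zero] using this

theorem algHom_quotient_ext (h : IsEtaleNbhd I B) (f g : B →ₐ[A] A ⧸ I) : f = g := by
  ext b
  have := h.sub_mem (K := (⊥ : Ideal (A ⧸ I))) ?_ f g b
  · simpa [sub_eq_zero] using this
  · rw [Ideal.map_le_iff_le_comap]
    intro i hi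
    exact Ideal.Quotient.eq_zero_iff_mem.mpr hi

theorem ker_eq (h : IsEtaleNbhd I B) (f : B →ₐ[A] A ⧸ I) :
    RingHom.ker f = I.map (algebraMap A B) := by
  obtain ⟨π, hπ⟩ := h.exists_ker_eq
  rw [h.algHom_quotient_ext f π, hπ]

theorem of_equiv (h : IsEtaleNbhd I B) {C : Type u} [CommRing C] [Algebra A C] (e : B ≃ₐ[A] C) :
    IsEtaleNbhd I C := by
  have := h.etale
  obtain ⟨π, hπ⟩ := h.exists_ker_eq
  have : Algebra.Etale A C := .of_equiv e
  refine of_exists_sub_mem (π.comp e.symm.toAlgHom) fun c => ?_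
  obtain ⟨a, ha⟩ := h.exists_sub_mem (e.symm c)
  refine ⟨a, ?_⟩
  simpa using e.toAlgHom.apply_mem_map_algebraMap ha

theorem self (I : Ideal A) : IsEtaleNbhd I A :=
  of_exists_sub_mem (Algebra.ofId A _) fun a => ⟨a, by simp⟩

theorem baseChange (h : IsEtaleNbhd I B) {D : Type u} [CommRing D] [Algebra A D] {K : Ideal D}
    (hK : I.map (algebraMap A D) ≤ K) : IsEtaleNbhd K (D ⊗[A] B) := by
  have := h.etale
  obtain ⟨π, hπ⟩ := h.exists_ker_eq
  let q : A ⧸ I →ₐ[A] D ⧸ K := Ideal.Quotient.liftₐ I (Algebra.ofId A (D ⧸ K)) fun i hi => by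
    change Ideal.Quotient.mk K (algebraMap A D i) = 0
    exact Ideal.Quotient.eq_zero_iff_mem.mpr (hK (Ideal.mem_map_of_mem _ hi))
  refine of_exists_sub_mem (Algebra.TensorProduct.lift (Algebra.ofId D (D ⧸ K)) (q.comp π)
    fun _ _ => Commute.all _ _) fun x => ?_
  induction x with
  | zero => exact ⟨0, by simp⟩
  | add x y hx hy =>
    obtain ⟨a, ha⟩ := hx
    obtain ⟨b, hb⟩ := hy
    refine ⟨a + b, ?_⟩
    rw [map_add, add_sub_add_comm]
    exact add_mem ha hb
  | tmul d b =>
    obtain ⟨a, ha⟩ := h.exists_sub_mem b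
    refine ⟨d * algebraMap A D a, ?_⟩
    let ι : B →ₐ[A] D ⊗[A] B := Algebra.TensorProduct.includeRight
    have e : d ⊗ₜ[A] b - algebraMap D (D ⊗[A] B) (d * algebraMap A D a) =
        d ⊗ₜ[A] 1 * ι (b - algebraMap A B a) := by
      rw [map_sub, mul_sub, ι.commutes, IsScalarTower.algebraMap_apply A D (D ⊗[A] B),
        Algebra.TensorProduct.algebraMap_apply, Algebra.TensorProduct.algebraMap_apply]
      simp [ι]
    rw [e]
    refine Ideal.mul_mem_left _ _ ?_
    have h1 := ι.apply_mem_map_algebraMap ha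
    rw [IsScalarTower.algebraMap_eq A D, ← Ideal.map_map] at h1
    exact Ideal.map_mono hK h1

theorem comp (h : IsEtaleNbhd I B) {C : Type u} [CommRing C] [Algebra A C] [Algebra B C]
    [IsScalarTower A B C] (h' : IsEtaleNbhd (I.map (algebraMap A B)) C) : IsEtaleNbhd I C := by
  have := h.etale
  have := h'.etale
  have : Algebra.Etale A C := .comp A B C
  obtain ⟨π, hπ⟩ := h.exists_ker_eq
  obtain ⟨ρ, hρ⟩ := h'.exists_ker_eq
  let q : (B ⧸ I.map (algebraMap A B)) →ₐ[A] A ⧸ I :=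
    Ideal.Quotient.liftₐ _ π fun b hb => π.map_le_ker_quotient hb
  refine of_exists_sub_mem (q.comp (ρ.restrictScalars A)) fun c => ?_
  obtain ⟨b, hb⟩ := h'.exists_sub_mem c
  obtain ⟨a, ha⟩ := h.exists_sub_mem b
  refine ⟨a, ?_⟩
  have h1 := Ideal.mem_map_of_mem (algebraMap B C) ha
  rw [Ideal.map_map, ← IsScalarTower.algebraMap_eq A B C] at hb h1
  rw [map_sub, ← IsScalarTower.algebraMap_apply A B C] at h1
  simpa using add_mem hb h1

/-- Since `c` is already `1` modulo `I`, inverting it changes nothing there. These neighbourhoods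
kill idempotents of `I` and put `I` into the Jacobson radical of the colimit. -/
theorem localizationAway {c : A} (hc : 1 - c ∈ I) : IsEtaleNbhd I (Localization.Away c) := by
  have hu : Ideal.Quotient.mk I c = 1 :=
    ((Ideal.Quotient.mk_eq_mk_iff_sub_mem 1 c).mpr hc).symm
  have : Algebra.Etale A (Localization.Away c) := .of_isLocalizationAway c
  let π : Localization.Away c →ₐ[A] A ⧸ I :=
    { IsLocalization.Away.lift c (g := Ideal.Quotient.mk I) (by rw [hu]; exact isUnit_one) with
      commutes' := fun a => IsLocalization.Away.lift_eq c _ a }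
  refine of_exists_sub_mem π fun z => ?_
  obtain ⟨n, a, hz⟩ := IsLocalization.Away.surj c z
  refine ⟨a, ?_⟩
  have h1 : 1 - c ^ n ∈ I := by
    rw [← Ideal.Quotient.eq_zero_iff_mem, map_sub, map_pow, hu]
    simp
  rw [← hz]
  have := Ideal.mul_mem_left _ z (Ideal.mem_map_of_mem (algebraMap A (Localization.Away c)) h1)
  simpa [mul_sub] using this

theorem bijective_includeRight (h : IsEtaleNbhd I B) : Function.Bijective
    (Algebra.TensorProduct.includeRight : (A ⧸ I) →ₐ[A] B ⊗[A] (A ⧸ I)) := by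
  obtain ⟨π, hπ⟩ := h.exists_ker_eq
  constructor
  · let r : B ⊗[A] (A ⧸ I) →ₐ[A] A ⧸ I :=
      Algebra.TensorProduct.lift π (AlgHom.id A _) fun _ _ => Commute.all _ _
    exact Function.LeftInverse.injective (g := r) fun z => by simp [r]
  · intro z
    obtain ⟨b, rfl⟩ := (Algebra.TensorProduct.quotIdealMapEquivTensorQuot B I).surjective z
    obtain ⟨b, rfl⟩ := Ideal.Quotient.mk_surjective b
    obtain ⟨a, ha⟩ := h.exists_sub_mem b
    refine ⟨Ideal.Quotient.mk I a, ?_⟩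
    have h1 : Ideal.Quotient.mk (I.map (algebraMap A B)) b =
      Ideal.Quotient.mk (I.map (algebraMap A B)) (algebraMap A B a) :=
      (Ideal.Quotient.mk_eq_mk_iff_sub_mem _ _).mpr ha
    rw [h1]
    exact ((Algebra.TensorProduct.includeRight : (A ⧸ I) →ₐ[A] B ⊗[A] (A ⧸ I)).commutes a).trans
      (((Algebra.TensorProduct.quotIdealMapEquivTensorQuot B I).restrictScalars A).commutes a).symm

theorem of_bijective_includeRight [Algebra.Etale A B] (h : Function.Bijective
    (Algebra.TensorProduct.includeRight : (A ⧸ I) →ₐ[A] B ⊗[A] (A ⧸ I))) : IsEtaleNbhd I B := by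
  let e := AlgEquiv.ofBijective _ h
  let f := (Algebra.TensorProduct.quotIdealMapEquivTensorQuot B I).restrictScalars A
  refine ⟨inferInstance, ((e.symm.toAlgHom.comp f.toAlgHom).comp
    (Ideal.Quotient.mkₐ A (I.map (algebraMap A B)))), ?_⟩
  ext b
  rw [RingHom.mem_ker]
  simp [Ideal.Quotient.eq_zero_iff_mem]

end IsEtaleNbhd

theorem IsHenselianPair.exists_algHom {K : Ideal A} (hK : IsHenselianPair K)
    (h : IsEtaleNbhd K B) : Nonempty (B →ₐ[A] A) :=
  have := h.etale
  hK.exists_section B h.bijective_includeRight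

end EtaleNbhd

/-! ### The henselization of a pair -/

section Henselization

variable {A : Type u} [CommRing A]

/-- A small set of representatives of the étale neighbourhoods of `(A, I)`. -/
structure EtaleNbhd (I : Ideal A) : Type u where
  numVars : ℕ
  rels : Ideal (MvPolynomial (Fin numVars) A)
  isEtaleNbhd : IsEtaleNbhd I (MvPolynomial (Fin numVars) A ⧸ rels)

namespace EtaleNbhd

variable {I : Ideal A}

/-- The underlying algebra of an étale neighbourhood. -/
abbrev Ring (s : EtaleNbhd I) : Type u := MvPolynomial (Fin s.numVars) A ⧸ s.rels

instance : SmallCategory (EtaleNbhd I) where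
  Hom s s' := s.Ring →ₐ[A] s'.Ring
  id s := AlgHom.id A s.Ring
  comp f g := AlgHom.comp g f

/-- The morphism of étale neighbourhoods given by a homomorphism of algebras. -/
def homMk {s s' : EtaleNbhd I} (f : s.Ring →ₐ[A] s'.Ring) : s ⟶ s' := f

/-- The homomorphism of algebras underlying a morphism of étale neighbourhoods. -/
def algHom {s s' : EtaleNbhd I} (f : s ⟶ s') : s.Ring →ₐ[A] s'.Ring := f

/-- Étale algebras are finitely presented, so the small index category misses none up to
isomorphism. -/
theorem exists_equiv {B : Type u} [CommRing B] [Algebra A B] (h : IsEtaleNbhd I B) :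
    ∃ s : EtaleNbhd I, Nonempty (B ≃ₐ[A] s.Ring) := by
  have := h.etale
  obtain ⟨n, r, e, -⟩ := (Algebra.FinitePresentation.iff (R := A) (A := B)).mp inferInstance
  exact ⟨⟨n, r, h.of_equiv e.symm⟩, ⟨e.symm⟩⟩

theorem exists_hom_of_mem_map (s : EtaleNbhd I) {c : s.Ring}
    (hc : 1 - c ∈ I.map (algebraMap A s.Ring)) :
    ∃ (s' : EtaleNbhd I) (f : s ⟶ s'), IsUnit (algHom f c) := by
  obtain ⟨s', ⟨e⟩⟩ := exists_equiv (s.isEtaleNbhd.comp (IsEtaleNbhd.localizationAway hc))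
  refine ⟨s', homMk (e.toAlgHom.comp (IsScalarTower.toAlgHom A s.Ring (Localization.Away c))), ?_⟩
  exact (IsLocalization.Away.algebraMap_isUnit (S := Localization.Away c) c).map e

instance : Nonempty (EtaleNbhd I) := ⟨(exists_equiv (IsEtaleNbhd.self I)).choose⟩

/-- Tensor products give upper bounds. Parallel maps are equalized by inverting `1 - e`, where `e`
is the idempotent generating an ideal that contains their differences. -/
instance : IsFiltered (EtaleNbhd I) where
  cocone_objs s s' := by
    obtain ⟨s'', ⟨e⟩⟩ := exists_equiv (s.isEtaleNbhd.comp (s'.isEtaleNbhd.baseChange le_rfl))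
    exact ⟨s'', homMk (e.toAlgHom.comp Algebra.TensorProduct.includeLeft),
      homMk (e.toAlgHom.comp Algebra.TensorProduct.includeRight), trivial⟩
  cocone_maps s s' f g := by
    have := s.isEtaleNbhd.etale
    obtain ⟨e, heI, he, hfg⟩ := Algebra.FormallyUnramified.exists_idempotent_sub_mem _
      (algHom f) (algHom g) (s.isEtaleNbhd.sub_mem le_rfl (algHom f) (algHom g))
    obtain ⟨s'', h, hu⟩ := s'.exists_hom_of_mem_map (c := 1 - e) (by simpa using heI)
    refine ⟨s'', h, AlgHom.ext fun b => ?_⟩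
    have h0 : algHom h e = 0 := by
      refine hu.mul_right_eq_zero.mp ?_
      rw [← map_mul, sub_mul, one_mul, he.eq, sub_self, map_zero]
    obtain ⟨d, hd⟩ := Ideal.mem_span_singleton'.mp (hfg b)
    have : algHom h (algHom f b - algHom g b) = 0 := by rw [← hd, map_mul, h0, mul_zero]
    rw [map_sub, sub_eq_zero] at this
    exact this

variable (I) in
/-- The diagram of all étale neighbourhoods. -/
def diagram : EtaleNbhd I ⥤ CommRingCat.{u} where
  obj s := CommRingCat.of s.Ring
  map f := CommRingCat.ofHom (algHom f).toRingHom

end EtaleNbhd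

open EtaleNbhd

variable (I : Ideal A)

/-- The henselization of `(A, I)`: the colimit of all étale neighbourhoods. -/
def Henselization : Type u := (Limits.colimit (diagram I) : CommRingCat.{u})

namespace Henselization

instance : CommRing (Henselization I) :=
  inferInstanceAs (CommRing (Limits.colimit (diagram I) : CommRingCat.{u}))

variable {I}

/-- The canonical ring homomorphism from an étale neighbourhood to the henselization. -/
def ιRingHom (s : EtaleNbhd I) : s.Ring →+* Henselization I :=
  (Limits.colimit.ι (diagram I) s).hom

theorem ιRingHom_algHom {s s' : EtaleNbhd I} (f : s ⟶ s') (b : s.Ring) :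
    ιRingHom s' (algHom f b) = ιRingHom s b :=
  congr($(Limits.colimit.w (diagram I) f).hom b)

theorem ιRingHom_algebraMap (s s' : EtaleNbhd I) (a : A) :
    ιRingHom s (algebraMap A s.Ring a) = ιRingHom s' (algebraMap A s'.Ring a) := by
  rw [← ιRingHom_algHom (IsFiltered.leftToMax s s'), ← ιRingHom_algHom (IsFiltered.rightToMax s s'),
    AlgHom.commutes, AlgHom.commutes]

/-- The choice of stage is immaterial by `ιRingHom_algebraMap`. -/
instance : Algebra A (Henselization I) :=
  ((ιRingHom (Classical.arbitrary (EtaleNbhd I))).comp (algebraMap A _)).toAlgebra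

/-- The canonical homomorphism from an étale neighbourhood to the henselization. -/
def ι (s : EtaleNbhd I) : s.Ring →ₐ[A] Henselization I where
  __ := ιRingHom s
  commutes' a := ιRingHom_algebraMap s _ a

theorem ι_algHom {s s' : EtaleNbhd I} (f : s ⟶ s') (b : s.Ring) : ι s' (algHom f b) = ι s b :=
  ιRingHom_algHom f b

theorem exists_ι_eq (x : Henselization I) : ∃ (s : EtaleNbhd I) (b : s.Ring), ι s b = x :=
  Limits.Concrete.colimit_exists_rep (diagram I) x

theorem exists_hom_eq_zero (s : EtaleNbhd I) (b : s.Ring) (hb : ι s b = 0) :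
    ∃ (s' : EtaleNbhd I) (f : s ⟶ s'), algHom f b = 0 := by
  obtain ⟨s', f, g, h⟩ := Limits.Concrete.colimit_exists_of_rep_eq (diagram I) (i := s) (j := s)
    b (0 : s.Ring) (by exact hb.trans (map_zero (ι s)).symm)
  exact ⟨s', f, h.trans (map_zero (algHom g))⟩

/-- A compatible family of homomorphisms on all étale neighbourhoods. -/
theorem exists_algHom {B : Type u} [CommRing B] [Algebra A B] (f : ∀ s : EtaleNbhd I, s.Ring →ₐ[A] B)
    (h : ∀ (s s' : EtaleNbhd I) (g : s ⟶ s'), (f s').comp (algHom g) = f s) :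
    ∃ F : Henselization I →ₐ[A] B, ∀ s, F.comp (ι s) = f s := by
  let c : Limits.Cocone (diagram I) :=
    { pt := CommRingCat.of B
      ι := { app := fun s => CommRingCat.ofHom (f s).toRingHom
             naturality := fun s s' g => by
              ext b
              exact congr($(h s s' g) b) } }
  let F : Henselization I →+* B := (Limits.colimit.desc (diagram I) c).hom
  have hF : ∀ s b, F (ι s b) = f s b := fun s b =>
    congr($(Limits.colimit.ι_desc c s).hom b)
  refine ⟨{ F with commutes' := fun a => ?_ }, fun s => AlgHom.ext fun b => hF s b⟩
  change F _ = _
  rw [← (ι (Classical.arbitrary (EtaleNbhd I))).commutes, hF, AlgHom.commutes]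

variable (I) in
theorem exists_algHom_ker_eq : ∃ π : Henselization I →ₐ[A] A ⧸ I,
    RingHom.ker π = I.map (algebraMap A (Henselization I)) := by
  choose π hπ using fun s : EtaleNbhd I => s.isEtaleNbhd.exists_ker_eq
  obtain ⟨p, hp⟩ := exists_algHom π fun s s' g => s.isEtaleNbhd.algHom_quotient_ext _ _
  refine ⟨p, le_antisymm (fun x hx => ?_) p.map_le_ker_quotient⟩
  obtain ⟨s, b, rfl⟩ := exists_ι_eq x
  have hb : b ∈ RingHom.ker (π s) := by
    rw [RingHom.mem_ker] at hx ⊢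
    rw [← hp s]
    exact hx
  rw [hπ] at hb
  exact (ι s).apply_mem_map_algebraMap hb

/-- The map of the henselization to `A/I` restricts at each stage to a map whose kernel is the
extension of `I`, so any representative of `x` will do. -/
theorem exists_mem_map_ι_eq {x : Henselization I}
    (hx : x ∈ I.map (algebraMap A (Henselization I))) :
    ∃ (s : EtaleNbhd I) (b : s.Ring), b ∈ I.map (algebraMap A s.Ring) ∧ ι s b = x := by
  obtain ⟨π, hπ⟩ := exists_algHom_ker_eq I
  obtain ⟨s, b, rfl⟩ := exists_ι_eq x
  refine ⟨s, b, ?_, rfl⟩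
  rw [← s.isEtaleNbhd.ker_eq (π.comp (ι s)), RingHom.mem_ker]
  rw [← hπ, RingHom.mem_ker] at hx
  exact hx

theorem map_le_jacobson :
    I.map (algebraMap A (Henselization I)) ≤ Ring.jacobson (Henselization I) := by
  intro x hx
  rw [← Ideal.jacobson_bot, Ideal.mem_jacobson_bot]
  intro y
  obtain ⟨s, b, hb, hbx⟩ := exists_mem_map_ι_eq (neg_mem (Ideal.mul_mem_right y _ hx))
  obtain ⟨s', f, hf⟩ := s.exists_hom_of_mem_map (c := 1 - b) (by simpa using hb)
  have := hf.map (ι s')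
  rw [ι_algHom, map_sub, map_one, hbx] at this
  simpa [add_comm] using this

/-- Every étale neighbourhood maps to the henselization. -/
theorem nonempty_algHom {B : Type u} [CommRing B] [Algebra A B] (h : IsEtaleNbhd I B) :
    Nonempty (B →ₐ[A] Henselization I) := by
  obtain ⟨s, ⟨e⟩⟩ := exists_equiv h
  exact ⟨(ι s).comp e.toAlgHom⟩

/-- A ring of finite type over `ℤ` that maps to the henselization maps to some étale
neighbourhood. -/
theorem exists_factor {R : Type u} [CommRing R] [Algebra.FinitePresentation ℤ R]
    (g : R →+* Henselization I) :
    ∃ (s : EtaleNbhd I) (g' : R →+* s.Ring), (ι s).toRingHom.comp g' = g := by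
  -- The integers are lifted to the universe of the diagram. As an initial object they make every
  -- compatibility over the base automatic.
  let Z := CommRingCat.of (ULift.{u} ℤ)
  let α : (Functor.const _).obj Z ⟶ diagram I :=
    { app := fun s => CommRingCat.isInitial.to _
      naturality := fun s s' f => CommRingCat.isInitial.hom_ext _ _ }
  let i : ULift.{u} ℤ →+* R := (algebraMap ℤ R).comp (ULift.ringEquiv : ULift.{u} ℤ ≃+* ℤ).toRingHom
  have hi : i.FinitePresentation := by
    refine RingHom.FinitePresentation.comp ?_ (.of_bijective ULift.ringEquiv.bijective)
    rwa [RingHom.finitePresentation_algebraMap]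
  obtain ⟨s, g', -, h⟩ := RingHom.EssFiniteType.exists_eq_comp_ι_app_of_isColimit Z (diagram I) α
    (S := CommRingCat.of R) (CommRingCat.ofHom i) _
    (Limits.colimit.isColimit (diagram I)) hi
    (CommRingCat.ofHom g) (fun s => CommRingCat.isInitial.hom_ext _ _)
  exact ⟨s, g'.hom, congr($(h.symm).hom)⟩

end Henselization

end Henselization

/-! ### Henselian property, universal property and flatness of the henselization -/

section Henselization

/-- If `C/K` and `H/J` are identified as `R`-algebras, then `C ⊗ E` is an étale neighbourhood of
`(C, K)` as soon as `H ⊗ E` is one of `(H, J)`. -/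
theorem IsEtaleNbhd.of_quotient_equiv {R C H E Q : Type u} [CommRing R] [CommRing C] [CommRing H]
    [CommRing E] [CommRing Q] [Algebra R C] [Algebra R H] [Algebra R E] [Algebra R Q]
    [Algebra.Etale R E] (p : C →ₐ[R] Q) (q : H →ₐ[R] Q) (hp : Function.Surjective p)
    (hq : Function.Surjective q) (h : IsEtaleNbhd (RingHom.ker q) (H ⊗[R] E)) :
    IsEtaleNbhd (RingHom.ker p) (C ⊗[R] E) := by
  obtain ⟨ρ, hρ⟩ := h.exists_ker_eq
  let eq : (H ⧸ RingHom.ker q) ≃ₐ[R] Q := Ideal.quotientKerAlgEquivOfSurjective hq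
  let ep : (C ⧸ RingHom.ker p) ≃ₐ[R] Q := Ideal.quotientKerAlgEquivOfSurjective hp
  let m : H ⊗[R] E →ₐ[R] Q := eq.toAlgHom.comp (ρ.restrictScalars R)
  let ν : E →ₐ[R] Q := m.comp Algebra.TensorProduct.includeRight
  -- The hypothesis on `H` says exactly that `μ` is injective. This statement involves only `Q` and
  -- `E`, so it can be transported to `C`.
  let μ : Q ⊗[R] E →ₐ[R] Q := Algebra.TensorProduct.lift (AlgHom.id R Q) ν fun _ _ => Commute.all _ _
  have hmq : ∀ w, μ (Algebra.TensorProduct.map q (AlgHom.id R E) w) = m w := by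
    refine DFunLike.congr_fun (f := μ.comp (Algebra.TensorProduct.map q (AlgHom.id R E))) (g := m) ?_
    refine Algebra.TensorProduct.ext ?_ ?_
    · ext x
      have : ρ (x ⊗ₜ 1) = Ideal.Quotient.mk _ x := ρ.commutes x
      simp [μ, m, this, eq]
    · ext x
      simp [μ, ν]
  have hμ : ∀ z, μ z = 0 → z = 0 := by
    intro z hz
    obtain ⟨w, rfl⟩ := Algebra.TensorProduct.map_surjective q (AlgHom.id R E) hq
      Function.surjective_id z
    rw [hmq] at hz
    have hw : w ∈ RingHom.ker ρ := by simpa [m] using hz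
    rw [hρ] at hw
    have : (RingHom.ker q).map (algebraMap H (H ⊗[R] E)) ≤
        RingHom.ker (Algebra.TensorProduct.map q (AlgHom.id R E)) :=
      (Algebra.TensorProduct.rTensor_ker (C := E) q hq).ge
    exact this hw
  let π : C ⊗[R] E →ₐ[C] C ⧸ RingHom.ker p := Algebra.TensorProduct.lift (Algebra.ofId C _)
    (ep.symm.toAlgHom.comp ν) fun _ _ => Commute.all _ _
  have hπ : ∀ w, ep (π w) = μ (Algebra.TensorProduct.map p (AlgHom.id R E) w) := by
    refine DFunLike.congr_fun (f := ep.toAlgHom.comp (π.restrictScalars R))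
      (g := μ.comp (Algebra.TensorProduct.map p (AlgHom.id R E))) ?_
    refine Algebra.TensorProduct.ext ?_ ?_
    · ext x
      simp [π, μ, Algebra.ofId_apply]
      rfl
    · ext x
      simp [π, μ]
  refine ⟨inferInstance, π, le_antisymm (fun w hw => ?_) π.map_le_ker_quotient⟩
  rw [RingHom.mem_ker] at hw
  have h0 : w ∈ RingHom.ker (Algebra.TensorProduct.map p (AlgHom.id R E)) := by
    refine hμ _ ?_
    rw [← hπ, hw, map_zero]
  exact (Algebra.TensorProduct.rTensor_ker (C := E) p hp).le h0

variable {A : Type u} [CommRing A] {I : Ideal A}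

namespace Henselization

open EtaleNbhd

variable (I) in
-- Write the étale algebra as `D = H ⊗_R E` with `R ⊆ H` of finite type over `ℤ`, and factor `R → H`
-- through a stage `B`. As `B` and `H` have the same quotient `A/I`, the algebra `B ⊗_R E` is an
-- étale neighbourhood of `(A, I)`. It therefore maps to `H`, and restricting to `E` gives the
-- section.
theorem isHenselianPair : IsHenselianPair (I.map (algebraMap A (Henselization I))) where
  le_jacobson := map_le_jacobson
  exists_section D _ _ _ hD := by
    replace hD := IsEtaleNbhd.of_bijective_includeRight hD
    obtain ⟨R, E, _, _, hfg, hE, ⟨e⟩⟩ :=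
      Algebra.Etale.exists_subalgebra_fg ℤ (Henselization I) D
    have : Algebra.FiniteType ℤ R := R.fg_iff_finiteType.mp hfg
    have : Algebra.FinitePresentation ℤ R := Algebra.FinitePresentation.of_finiteType.mp this
    obtain ⟨s, g, hg⟩ := exists_factor (algebraMap R (Henselization I))
    obtain ⟨π, hπ⟩ := exists_algHom_ker_eq I
    let _ : Algebra R s.Ring := g.toAlgebra
    let _ : Algebra R (A ⧸ I) := (π.toRingHom.comp (algebraMap R _)).toAlgebra
    let q : Henselization I →ₐ[R] A ⧸ I := { π with commutes' := fun _ => rfl }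
    let ιR : s.Ring →ₐ[R] Henselization I := { ι s with commutes' := fun r => congr($hg r) }
    have hq : IsEtaleNbhd (RingHom.ker q) (Henselization I ⊗[R] E) := by
      have : RingHom.ker q = I.map (algebraMap A (Henselization I)) := hπ
      rw [this]
      exact hD.of_equiv e
    have hp := IsEtaleNbhd.of_quotient_equiv (q.comp ιR) q (π.comp (ι s)).quotient_surjective
      π.quotient_surjective hq
    have hker : RingHom.ker (q.comp ιR) = I.map (algebraMap A s.Ring) :=
      s.isEtaleNbhd.ker_eq (π.comp (ι s))
    rw [hker] at hp
    have : SMulCommClass R A s.Ring := ⟨fun r a x => by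
      rw [Algebra.smul_def r, Algebra.smul_def r, mul_smul_comm]⟩
    have hsc : IsScalarTower A s.Ring (s.Ring ⊗[R] E) := inferInstance
    obtain ⟨f⟩ := nonempty_algHom (s.isEtaleNbhd.comp hp)
    -- A priori `f` is only `A`-linear; rigidity forces it to extend `ι s`, which makes its
    -- restriction to `E` linear over `R`.
    have hf : f.comp (IsScalarTower.toAlgHom A s.Ring (s.Ring ⊗[R] E)) = ι s :=
      s.isEtaleNbhd.algHom_ext le_rfl map_le_jacobson _ _
    let fE : E →ₐ[R] Henselization I :=
      { f.toRingHom.comp (Algebra.TensorProduct.includeRight : E →ₐ[R] s.Ring ⊗[R] E).toRingHom with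
        commutes' := fun r => by
          have h1 := congr($hf (g r))
          have h2 := congr($hg r)
          have h3 : (1 : s.Ring) ⊗ₜ[R] (algebraMap R E r) = (g r) ⊗ₜ[R] (1 : E) :=
            (Algebra.TensorProduct.includeRight : E →ₐ[R] s.Ring ⊗[R] E).commutes r
          change f ((1 : s.Ring) ⊗ₜ[R] (algebraMap R E r)) = _
          rw [h3]
          exact h1.trans h2 }
    exact ⟨(Algebra.TensorProduct.lift (AlgHom.id _ _) fE fun _ _ => Commute.all _ _).comp
      e.toAlgHom⟩

variable (I) in
theorem comap_map : (I.map (algebraMap A (Henselization I))).comap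
    (algebraMap A (Henselization I)) = I := by
  obtain ⟨π, hπ⟩ := exists_algHom_ker_eq I
  refine le_antisymm (fun a ha => ?_) Ideal.le_comap_map
  rw [Ideal.mem_comap, ← hπ, RingHom.mem_ker, π.commutes] at ha
  exact Ideal.Quotient.eq_zero_iff_mem.mp ha

/-- Each stage, base changed to `B`, is an étale neighbourhood of `(B, K)` and so has a section.
Rigidity makes the resulting maps compatible and unique. -/
theorem exists_algHom_forall_eq {B : Type u} [CommRing B] [Algebra A B] {K : Ideal B}
    (hK : IsHenselianPair K) (hI : I.map (algebraMap A B) ≤ K) :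
    ∃ f : Henselization I →ₐ[A] B, ∀ g, g = f := by
  have hex : ∀ s : EtaleNbhd I, Nonempty (s.Ring →ₐ[A] B) := fun s => by
    obtain ⟨f⟩ := hK.exists_algHom (s.isEtaleNbhd.baseChange hI)
    exact ⟨(f.restrictScalars A).comp Algebra.TensorProduct.includeRight⟩
  obtain ⟨F, -⟩ := exists_algHom (fun s => (hex s).some)
    fun s s' g => s.isEtaleNbhd.algHom_ext hI hK.le_jacobson _ _
  refine ⟨F, fun G => AlgHom.ext fun x => ?_⟩
  obtain ⟨s, b, rfl⟩ := exists_ι_eq x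
  exact congr($(s.isEtaleNbhd.algHom_ext hI hK.le_jacobson (G.comp (ι s)) (F.comp (ι s))) b)

variable (I) in
theorem isHenselization : IsHenselization I (I.map (algebraMap A (Henselization I)))
    (algebraMap A (Henselization I)) where
  isHenselianPair := isHenselianPair I
  isPairMorphism := comap_map I
  existsUnique_lift B _ K hK ψ hψ := by
    let _ : Algebra A B := ψ.toAlgebra
    have hI : I.map (algebraMap A B) ≤ K := Ideal.map_le_iff_le_comap.mpr hψ.ge
    obtain ⟨F, hF⟩ := exists_algHom_forall_eq hK hI
    refine ⟨F.toRingHom, ⟨?_, F.comp_algebraMap⟩, ?_⟩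
    -- Modulo the extension of `I`, every element `x` is the image of some `a` in `A`, so membership
    -- can be tested on `a`.
    · ext x
      obtain ⟨π, hπ⟩ := exists_algHom_ker_eq I
      obtain ⟨a, ha⟩ := Ideal.Quotient.mk_surjective (π x)
      have hx : x - algebraMap A _ a ∈ I.map (algebraMap A (Henselization I)) := by
        rw [← hπ, RingHom.mem_ker, map_sub, π.commutes, ← ha]
        exact sub_self _
      have hFx : F x - algebraMap A B a ∈ K := by
        rw [← F.commutes, ← map_sub]
        exact hI (F.apply_mem_map_algebraMap hx)
      rw [← sub_add_cancel x (algebraMap A _ a), Ideal.add_mem_iff_right _ hx, Ideal.mem_comap]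
      change F _ ∈ K ↔ _
      rw [map_add, map_sub, F.commutes, Ideal.add_mem_iff_right _ hFx, ← Ideal.mem_comap,
        ← Ideal.mem_comap, comap_map]
      rw [show algebraMap A B = ψ from rfl, hψ]
    · rintro G ⟨-, hG⟩
      exact congr($(hF { G with commutes' := fun a => congr($hG a) }).toRingHom)

/-- Annihilators of elements commute with henselization. -/
theorem mem_map_of_mul_eq_zero {a : A} {T : Ideal A} (hT : ∀ z, a * z = 0 → z ∈ T)
    {x : Henselization I} (hx : algebraMap A _ a * x = 0) :
    x ∈ T.map (algebraMap A (Henselization I)) := by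
  obtain ⟨s, b, rfl⟩ := exists_ι_eq x
  rw [← (ι s).commutes, ← map_mul] at hx
  obtain ⟨s', f, hf⟩ := exists_hom_eq_zero s _ hx
  rw [map_mul, AlgHom.commutes, ← Algebra.smul_def] at hf
  rw [← ι_algHom f]
  refine (ι s').apply_mem_map_algebraMap ?_
  generalize algHom f b = c at hf ⊢
  have := s'.isEtaleNbhd.etale
  -- Equational criterion of flatness: `a c = 0` in the flat stage forces `c = ∑ d_j y_j` with `a
  -- d_j = 0` in `A`.
  obtain ⟨κ, d, y, h1, h2⟩ := Module.Flat.isTrivialRelation_of_sum_smul_eq_zero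
    (R := A) (ι := Unit) (f := fun _ => a) (x := fun _ => c) (by simpa using hf)
  rw [show c = _ from h1 ()]
  refine sum_mem fun j _ => ?_
  rw [Algebra.smul_def (d () j) (y j)]
  exact Ideal.mul_mem_right _ _ (Ideal.mem_map_of_mem _ (hT _ (by simpa using h2 j)))

end Henselization

end Henselization

/-! ### Nilpotent pairs -/

/-- Formal smoothness lifts a section modulo a nilpotent ideal. -/
theorem isHenselianPair_of_isNilpotent {A : Type u} [CommRing A] {K : Ideal A}
    (hK : IsNilpotent K) : IsHenselianPair K where
  le_jacobson := by
    obtain ⟨n, hn⟩ := hK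
    intro a ha
    have : IsNilpotent a := ⟨n, by
      have := Ideal.pow_mem_pow ha n
      rwa [hn] at this⟩
    rw [← Ideal.jacobson_bot]
    exact Ideal.radical_le_jacobson this
  exists_section B _ _ _ hB := by
    obtain ⟨-, π, -⟩ := IsEtaleNbhd.of_bijective_includeRight hB
    exact ⟨Algebra.FormallySmooth.lift K hK π⟩

/-! ### First Koszul homology -/

namespace Koszul

section

variable {A : Type u} [CommRing A] {M : Type u} [AddCommGroup M] [Module A M]

theorem contraction_zero_oneEquiv_symm (φ : Module.Dual A M) (v : M) :
    contraction φ 0 ((exteriorPower.oneEquiv A M).symm v) =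
      (exteriorPower.zeroEquiv A M).symm (φ v) := by
  refine Subtype.ext ?_
  have h1 : (((exteriorPower.oneEquiv A M).symm v : ⋀[A]^1 M) : ExteriorAlgebra A M) =
      CliffordAlgebra.ι (0 : QuadraticForm A M) v := by
    simp [exteriorPower.oneEquiv_symm_apply, ExteriorAlgebra.ιMulti_apply]
  have h2 : (((exteriorPower.zeroEquiv A M).symm (φ v) : ⋀[A]^0 M) : ExteriorAlgebra A M) =
      algebraMap A _ (φ v) := by
    simp [exteriorPower.zeroEquiv, Algebra.algebraMap_eq_smul_one]
  rw [h2]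
  refine Eq.trans ?_ (CliffordAlgebra.contractLeft_ι (Q := (0 : QuadraticForm A M)) φ v)
  rw [← h1]
  rfl

/-- The boundary of `x ∧ y` in the Koszul complex is `φ(x) y - φ(y) x`. -/
theorem contraction_one_ιMulti (φ : Module.Dual A M) (v : Fin 2 → M) :
    contraction φ 1 (exteriorPower.ιMulti A 2 v) =
      (exteriorPower.oneEquiv A M).symm (φ (v 0) • v 1 - φ (v 1) • v 0) := by
  refine Subtype.ext ?_
  have h1 : ∀ x, (((exteriorPower.oneEquiv A M).symm x : ⋀[A]^1 M) : ExteriorAlgebra A M) =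
      CliffordAlgebra.ι (0 : QuadraticForm A M) x := fun x => by
    simp [exteriorPower.oneEquiv_symm_apply, ExteriorAlgebra.ιMulti_apply]
  have h2 : (exteriorPower.ιMulti A 2 v : ExteriorAlgebra A M) =
      CliffordAlgebra.ι (0 : QuadraticForm A M) (v 0) *
        CliffordAlgebra.ι (0 : QuadraticForm A M) (v 1) := by
    simp [ExteriorAlgebra.ιMulti_apply]
    rfl
  rw [h1]
  have h3 : (contraction φ 1 (exteriorPower.ιMulti A 2 v) : ExteriorAlgebra A M) =
    CliffordAlgebra.contractLeft (Q := (0 : QuadraticForm A M)) φ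
      (exteriorPower.ιMulti A 2 v : ExteriorAlgebra A M) := rfl
  rw [h3, h2]
  rw [CliffordAlgebra.contractLeft_ι_mul, CliffordAlgebra.contractLeft_ι, map_sub, map_smul,
    map_smul, Algebra.smul_def (φ (v 1)), Algebra.commutes]

end

variable {A : Type u} [CommRing A] {r : ℕ}

theorem complex_d (a : Fin r → A) (k : ℕ) : (complex a).d (k + 1) k =
    ModuleCat.ofHom (contraction (Fintype.linearCombination A a) k) := by
  simp only [complex, ChainComplex.of_d]

/-- If the transition map on the first Koszul homology vanishes, then the image of every cycle is
a boundary. -/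
theorem exists_contraction_eq {a : Fin r → A} {n m : ℕ} (h : n ≤ m)
    (hz : HomologicalComplex.homologyMap (transition a h) 1 = 0) (f : Fin r → A)
    (hf : ∑ i, f i * a i ^ m = 0) :
    ∃ w, (exteriorPower.oneEquiv A (Fin r → A)).symm (diagonalPow a (m - n) f) =
      contraction (Fintype.linearCombination A fun i => a i ^ n) 1 w := by
  let K := complex fun i => a i ^ m
  let L := complex fun i => a i ^ n
  let x : ⋀[A]^1 (Fin r → A) := (exteriorPower.oneEquiv A (Fin r → A)).symm f
  -- The cycle is encoded as a morphism from `A`. Vanishing of its class gives a bounding chain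
  -- after an epimorphism onto `A`, and a preimage of `1` then yields an actual element.
  let γ : ModuleCat.of A A ⟶ K.X 1 := ModuleCat.ofHom (LinearMap.toSpanSingleton A _ x)
  have hγ : γ ≫ K.d 1 0 = 0 := by
    rw [show K.d 1 0 = _ from complex_d _ 0]
    refine ModuleCat.hom_ext (LinearMap.ext_ring ?_)
    change contraction _ 0 ((1 : A) • x) = 0
    rw [one_smul, contraction_zero_oneEquiv_symm, Fintype.linearCombination_apply]
    simp only [smul_eq_mul, hf, map_zero]
  have h0 : L.liftCycles (γ ≫ (transition a h).f 1) 0 (by simp)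
      (by rw [Category.assoc, HomologicalComplex.Hom.comm, reassoc_of% hγ, Limits.zero_comp]) ≫
        L.homologyπ 1 = 0 := by
    rw [← HomologicalComplex.liftCycles_comp_cyclesMap γ 0 (by simp) hγ (transition a h), Category.assoc,
      ← HomologicalComplex.homologyπ_naturality, hz, Limits.comp_zero, Limits.comp_zero]
  rw [HomologicalComplex.liftCycles_comp_homologyπ_eq_zero_iff_up_to_refinements _ 2 1 0 (by simp)
    (by simp)]
    at h0
  obtain ⟨B, p, hp, y, hy⟩ := h0
  obtain ⟨b, hb⟩ := (ModuleCat.epi_iff_surjective p).mp hp 1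
  refine ⟨y b, ?_⟩
  rw [show L.d 2 1 = _ from complex_d _ 1] at hy
  have h1 := congr($hy b)
  have h2 : (p ≫ γ ≫ (transition a h).f 1) b =
      exteriorPower.map 1 (diagonalPow a (m - n)) ((p b) • x) := rfl
  rw [h2, hb, one_smul] at h1
  have h3 := congr($(exteriorPower.oneEquiv_naturality (R := A) (diagonalPow a (m - n))) x)
  rw [LinearEquiv.symm_apply_eq]
  refine Eq.trans ?_ (congrArg (exteriorPower.oneEquiv A (Fin r → A)) h1)
  refine Eq.trans ?_ h3.symm
  simp [x]

/-- Boundaries of degree one in the Koszul complex of a sequence `a i = c i * t + d i * u` map to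
boundaries in the Koszul complex of `t, u`. -/
theorem exists_eq_mul_of_contraction {a c d : Fin r → A} {t u : A}
    (ha : ∀ i, a i = c i * t + d i * u) (w : ⋀[A]^2 (Fin r → A)) {v : Fin r → A}
    (hv : (exteriorPower.oneEquiv A (Fin r → A)).symm v =
      contraction (Fintype.linearCombination A a) 1 w) :
    ∃ h, ∑ i, v i * c i = u * h ∧ ∑ i, v i * d i = -(t * h) := by
  obtain ⟨v', rfl, hw⟩ : ∃ v', v = v' ∧
      ∃ h, ∑ i, v' i * c i = u * h ∧ ∑ i, v' i * d i = -(t * h) := by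
    rw [LinearEquiv.symm_apply_eq] at hv
    refine ⟨_, hv, ?_⟩
    clear hv
    have hw : w ∈ Submodule.span A (Set.range (exteriorPower.ιMulti A 2)) := by
      rw [exteriorPower.ιMulti_span]
      trivial
    induction hw using Submodule.span_induction with
    | mem w hw =>
      obtain ⟨z, rfl⟩ := hw
      rw [contraction_one_ιMulti, LinearEquiv.apply_symm_apply]
      -- Under `e_i ↦ (c_i, d_i)` the two vectors go to `A²`, and `h` is, up to sign, the
      -- determinant of their images.
      refine ⟨(∑ i, z 0 i * d i) * (∑ i, z 1 i * c i) -
        (∑ i, z 1 i * d i) * (∑ i, z 0 i * c i), ?_, ?_⟩ <;>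
      · simp only [Fintype.linearCombination_apply, smul_eq_mul, ha, mul_add, Pi.sub_apply,
          Pi.smul_apply, sub_mul, Finset.sum_sub_distrib, Finset.sum_add_distrib, mul_assoc,
          ← Finset.mul_sum]
        simp only [← mul_assoc, ← Finset.sum_mul]
        ring
    | zero => exact ⟨0, by simp⟩
    | add x y _ _ hx hy =>
      obtain ⟨h, h1, h2⟩ := hx
      obtain ⟨h', h1', h2'⟩ := hy
      refine ⟨h + h', ?_, ?_⟩
      · simp only [map_add, Pi.add_apply, add_mul, Finset.sum_add_distrib, h1, h1']
        ring
      · simp only [map_add, Pi.add_apply, add_mul, Finset.sum_add_distrib, h2, h2']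
        ring
    | smul b x _ hx =>
      obtain ⟨h, h1, h2⟩ := hx
      refine ⟨b * h, ?_, ?_⟩
      · simp only [map_smul, Pi.smul_apply, smul_eq_mul, mul_assoc, ← Finset.mul_sum, h1]
        ring
      · simp only [map_smul, Pi.smul_apply, smul_eq_mul, mul_assoc, ← Finset.mul_sum, h2]
        ring
  exact hw

end Koszul

/-- If `(t, u)` is weakly proregular, then the torsion of `t` in `A/u` is bounded in the following
sense. -/
theorem Ideal.IsWeaklyProregular.exists_pow_mul_mem {A : Type u} [CommRing A] {t u : A}
    (h : (Ideal.span {t, u}).IsWeaklyProregular) :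
    ∃ M : ℕ, 0 < M ∧ ∀ f, t ^ (M + 1) * f = 0 → t ^ M * f ∈ Ideal.span {u} := by
  obtain ⟨r, a, hspan, ha⟩ := h
  obtain ⟨m, hm, hz⟩ := ha 1 one_pos 1 one_pos
  have hcd : ∀ i, ∃ c d, a i = c * t + d * u := fun i => by
    have : a i ∈ Ideal.span {t, u} := hspan ▸ Ideal.subset_span ⟨i, rfl⟩
    obtain ⟨c, d, e⟩ := Ideal.mem_span_pair.mp this
    exact ⟨c, d, e.symm⟩
  choose c d hcd using hcd
  obtain ⟨M, hM0, p, hp⟩ : ∃ M : ℕ, 0 < M ∧ ∃ p : Fin r → A, t ^ M = ∑ i, p i * a i ^ m := by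
    have ht : t ∈ (Ideal.span (Set.range fun i => a i ^ m)).radical := by
      have hle : Ideal.span (Set.range a) ≤ (Ideal.span (Set.range fun i => a i ^ m)).radical := by
        rw [Ideal.span_le]
        rintro _ ⟨i, rfl⟩
        exact ⟨m, Ideal.subset_span ⟨i, rfl⟩⟩
      rw [hspan] at hle
      exact hle (Ideal.subset_span (by simp))
    obtain ⟨M, hM⟩ := ht
    -- The extra factor only serves to make the exponent positive.
    have hM' : t ^ (M + 1) ∈ Ideal.span (Set.range fun i => a i ^ m) := by
      rw [pow_succ]
      exact Ideal.mul_mem_right _ _ hM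
    obtain ⟨p, hp⟩ := Ideal.mem_span_range_iff_exists_fun.mp hM'
    exact ⟨M + 1, M.succ_pos, p, hp.symm⟩
  refine ⟨M, hM0, fun f hf => ?_⟩
  -- The chain `(p_i t f)` is a cycle because `∑ p_i a_i^m t f = t^(M+1) f = 0`. Its image `(p_i
  -- a_i^(m-1) t f)` bounds, so pairing it with `c` gives a multiple of `u`. Expanding one factor
  -- `a_i = c_i t + d_i u` in `t^M f = ∑ p_i a_i^m f` leaves only further multiples of `u`.
  obtain ⟨w, hw⟩ := Koszul.exists_contraction_eq hm.le hz (fun i => p i * (t * f)) (by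
    calc ∑ i, p i * (t * f) * a i ^ m = (∑ i, p i * a i ^ m) * (t * f) := by
          rw [Finset.sum_mul]
          exact Finset.sum_congr rfl fun i _ => by ring
      _ = 0 := by rw [← hp, ← hf]; ring)
  simp only [pow_one] at hw
  obtain ⟨h, h1, -⟩ := Koszul.exists_eq_mul_of_contraction hcd w hw
  have h2 : t ^ M * f = u * (h + (∑ i, p i * a i ^ (m - 1) * d i) * f) := by
    rw [mul_add, ← h1, hp]
    simp only [Finset.sum_mul, Finset.mul_sum, ← Finset.sum_add_distrib]
    refine Finset.sum_congr rfl fun i _ => ?_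
    have e : Koszul.diagonalPow a (m - 1) (fun i => p i * (t * f)) i =
      a i ^ (m - 1) * (p i * (t * f)) := rfl
    rw [e, ← Nat.sub_add_cancel hm.le, pow_succ]
    simp only [Nat.add_sub_cancel]
    nth_rewrite 2 [hcd i]
    ring
  rw [h2]
  exact Ideal.mul_mem_right _ _ (Ideal.mem_span_singleton_self u)

namespace Example

/-! ### Generators and relations of `A'₀` -/

section Generators

variable (k : Type u) [Field k]

/-- The structure map `k → A'₀`. -/
def scalar : k →+* A₀ k :=
  (Ideal.Quotient.mk (idealN k ⊔ idealN' k)).comp ((MvPolynomial.C).comp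
    ((Ideal.Quotient.mk (idealR k)).comp (Polynomial.C.comp MvPolynomial.C) : k →+* R k))

/-- The class of `x_i` in `A'₀`. -/
def xA (i : ℕ) : A₀ k := Ideal.Quotient.mk _ (MvPolynomial.C (x k i))

/-- The class of `y` in `R`. -/
def yR : R k := Ideal.Quotient.mk (idealR k) Polynomial.X

/-- The class of `y` in `A'₀`. -/
def yA : A₀ k := Ideal.Quotient.mk _ (MvPolynomial.C (yR k))

theorem xA_zero_mul_yA : xA k 0 * yA k = 0 := by
  have h : x k 0 * yR k = 0 :=
    (map_mul (Ideal.Quotient.mk (idealR k)) _ _).symm.trans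
      (Ideal.Quotient.eq_zero_iff_mem.mpr (Ideal.subset_span (Or.inl rfl)))
  rw [xA, yA, ← map_mul, ← map_mul, h, map_zero, map_zero]

theorem xA_succ_mul_yA (i : ℕ) : xA k (i + 1) * yA k = xA k i := by
  have h : x k (i + 1) * yR k = x k i :=
    (map_mul (Ideal.Quotient.mk (idealR k)) _ _).symm.trans
      ((Ideal.Quotient.mk_eq_mk_iff_sub_mem _ _).mpr
        (by
          rw [← neg_sub]
          exact neg_mem (Ideal.subset_span (Or.inr ⟨i, rfl⟩))))
  rw [xA, yA, ← map_mul, ← map_mul, h, xA]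

theorem xA_mul_t_pow (i : ℕ) : xA k i * t k ^ (i + 2) = 0 := by
  rw [xA, t, ← map_pow, ← map_mul]
  exact Ideal.Quotient.eq_zero_iff_mem.mpr (Ideal.mem_sup_left (Ideal.subset_span ⟨i, rfl⟩))

theorem xA_mul_t_pow_mul_u (i : ℕ) : xA k i * t k ^ i * u k = 0 := by
  rw [xA, t, u, ← map_pow, ← map_mul, ← map_mul]
  exact Ideal.Quotient.eq_zero_iff_mem.mpr (Ideal.mem_sup_right (Ideal.subset_span ⟨i, rfl⟩))

theorem xA_mul_yA_pow (i : ℕ) : xA k i * yA k ^ (i + 1) = 0 := by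
  induction i with
  | zero => simpa using xA_zero_mul_yA k
  | succ i ih => rw [pow_succ', ← mul_assoc, xA_succ_mul_yA, ih]

theorem xA_add_mul_yA_pow (i n : ℕ) : xA k (i + n) * yA k ^ n = xA k i := by
  induction n with
  | zero => simp
  | succ n ih => rw [pow_succ', ← mul_assoc, ← add_assoc, xA_succ_mul_yA, ih]

/-- `x_j` is divisible by `y^(i+1)`, which kills `x_i`. -/
theorem xA_mul_xA (i j : ℕ) : xA k i * xA k j = 0 := by
  rw [← xA_add_mul_yA_pow k j (i + 1), mul_left_comm, xA_mul_yA_pow, mul_zero]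

variable {k}

/-- A ring homomorphism out of `A'₀` is determined by its values on scalars and generators. -/
theorem ringHom_ext {S : Type*} [CommRing S] {f g : A₀ k →+* S}
    (hc : ∀ c, f (scalar k c) = g (scalar k c)) (hx : ∀ i, f (xA k i) = g (xA k i))
    (hy : f (yA k) = g (yA k)) (ht : f (t k) = g (t k)) (hu : f (u k) = g (u k)) : f = g := by
  refine Ideal.Quotient.ringHom_ext (MvPolynomial.ringHom_ext' ?_ fun i => ?_)
  · refine Ideal.Quotient.ringHom_ext (I := idealR k) (Polynomial.ringHom_ext' ?_ hy)
    exact MvPolynomial.ringHom_ext hc hx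
  · fin_cases i
    exacts [ht, hu]

/-- A ring homomorphism out of `A'₀` with prescribed values on scalars and generators. -/
theorem exists_ringHom {S : Type*} [CommRing S] (c : k →+* S) (x' : ℕ → S) (y' t' u' : S)
    (h0 : x' 0 * y' = 0) (h1 : ∀ i, x' (i + 1) * y' = x' i) (h2 : ∀ i, x' i * t' ^ (i + 2) = 0)
    (h3 : ∀ i, x' i * t' ^ i * u' = 0) :
    ∃ f : A₀ k →+* S, (∀ a, f (scalar k a) = c a) ∧ (∀ i, f (xA k i) = x' i) ∧ f (yA k) = y' ∧
      f (t k) = t' ∧ f (u k) = u' := by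
  let f₁ : Polynomial (MvPolynomial ℕ k) →+* S :=
    Polynomial.eval₂RingHom (MvPolynomial.eval₂Hom c x') y'
  let f₂ : R k →+* S := Ideal.Quotient.lift (idealR k) f₁ fun a ha => by
    refine (Ideal.span_le (I := RingHom.ker f₁)).mpr ?_ ha
    rintro _ (rfl | ⟨i, rfl⟩)
    · simpa [f₁, RingHom.mem_ker] using h0
    · simp [f₁, RingHom.mem_ker, h1]
  have hf₂ : ∀ i, f₂ (x k i) = x' i := fun i => by
    have : f₂ (x k i) = f₁ (Polynomial.C (MvPolynomial.X i)) := rfl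
    rw [this]
    simp [f₁]
  let f₃ : Rtu k →+* S := MvPolynomial.eval₂Hom f₂ ![t', u']
  let f₄ : A₀ k →+* S := Ideal.Quotient.lift _ f₃ fun a ha => by
    refine (sup_le (c := RingHom.ker f₃) (Ideal.span_le.mpr ?_) (Ideal.span_le.mpr ?_)) ha
    · rintro _ ⟨i, rfl⟩
      simpa [f₃, RingHom.mem_ker, hf₂] using h2 i
    · rintro _ ⟨i, rfl⟩
      simpa [f₃, RingHom.mem_ker, hf₂] using h3 i
  have h4 : ∀ b, f₄ (Ideal.Quotient.mk _ b) = f₃ b := fun b => rfl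
  have h5 : ∀ b, f₃ (MvPolynomial.C b) = f₂ b := fun b => by simp [f₃]
  refine ⟨f₄, fun a => ?_, fun i => ?_, ?_, ?_, ?_⟩
  · have : f₂ ((Ideal.Quotient.mk (idealR k)).comp (Polynomial.C.comp MvPolynomial.C) a : R k) =
      f₁ (Polynomial.C (MvPolynomial.C a)) := rfl
    refine (h5 _).trans (this.trans ?_)
    simp [f₁]
  · rw [xA, h4, h5, hf₂]
  · have : f₂ (yR k) = f₁ Polynomial.X := rfl
    rw [yA, h4, h5, this]
    simp [f₁]
  · rw [t, h4]
    simp [f₃]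
  · rw [u, h4]
    simp [f₃]

end Generators

/-! ### A normal form for the elements of `A'₀` -/

section NormalForm

variable (k : Type u) [Field k]

/-- The polynomial ring `k[y, t, u]`. -/
abbrev Poly : Type u := MvPolynomial (Fin 3) k

/-- The ring `k[y, y⁻¹, t, u]`; its monomial `y^(-i-1) t^a u^b` represents `x_i t^a u^b`. -/
abbrev Laurent : Type u := AddMonoidAlgebra k (ℤ × ℕ × ℕ)

/-- The exponents of `y, t, u`. -/
def expo : Fin 3 → ℤ × ℕ × ℕ := ![(1, 0, 0), (0, 1, 0), (0, 0, 1)]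

instance : Algebra (Poly k) (Laurent k) :=
  (MvPolynomial.eval₂Hom (algebraMap k (Laurent k))
    fun i => AddMonoidAlgebra.single (expo i) 1).toAlgebra

variable {k}

theorem C_smul (c : k) (f : Laurent k) : (MvPolynomial.C c : Poly k) • f = c • f := by
  rw [Algebra.smul_def, Algebra.smul_def]
  congr 1
  exact MvPolynomial.eval₂Hom_C _ _ c

theorem X_smul (i : Fin 3) (f : Laurent k) :
    (MvPolynomial.X i : Poly k) • f = AddMonoidAlgebra.single (expo i) 1 * f := by
  rw [Algebra.smul_def]
  congr 1
  exact MvPolynomial.eval₂Hom_X' _ _ i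

theorem X_smul_single (i : Fin 3) (g : ℤ × ℕ × ℕ) (c : k) :
    (MvPolynomial.X i : Poly k) • (AddMonoidAlgebra.single g c : Laurent k) =
      AddMonoidAlgebra.single (expo i + g) c := by
  rw [X_smul, AddMonoidAlgebra.single_mul_single, one_mul]

theorem X_pow_smul (i : Fin 3) (n : ℕ) (f : Laurent k) : (MvPolynomial.X i ^ n : Poly k) • f =
    AddMonoidAlgebra.single (n • expo i) 1 * f := by
  induction n with
  | zero => rw [pow_zero, one_smul, zero_smul, ← AddMonoidAlgebra.one_def, one_mul]
  | succ n ih =>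
    rw [pow_succ', mul_smul, ih, X_smul, ← mul_assoc, AddMonoidAlgebra.single_mul_single,
      one_mul, succ_nsmul']

theorem X_pow_smul_single (i : Fin 3) (n : ℕ) (g : ℤ × ℕ × ℕ) (c : k) :
    (MvPolynomial.X i ^ n : Poly k) • (AddMonoidAlgebra.single g c : Laurent k) =
      AddMonoidAlgebra.single (n • expo i + g) c := by
  rw [X_pow_smul, AddMonoidAlgebra.single_mul_single, one_mul]

/-- The exponents of the monomials that represent zero. -/
def zeroSet : Set (ℤ × ℕ × ℕ) :=
  -- For `y^(-i-1) t^a u^b` the three cases encode `x_i y^(i+1) = 0`, `x_i t^(i+2) = 0` and `x_i t^i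
  -- u = 0`.
  {g | 0 ≤ g.1 ∨ 1 ≤ g.1 + g.2.1 ∨ (1 ≤ g.2.2 ∧ 0 ≤ g.1 + g.2.1 + 1)}

theorem expo_add_mem_zeroSet (i : Fin 3) {g : ℤ × ℕ × ℕ} (hg : g ∈ zeroSet) :
    expo i + g ∈ zeroSet := by
  simp only [zeroSet, Set.mem_ofPred_eq] at hg ⊢
  fin_cases i <;> simp [expo] <;> omega

variable (k) in
/-- The span of the monomials that represent zero. -/
def zeroSubmodule : Submodule (Poly k) (Laurent k) where
  carrier := {f | ∀ g ∉ zeroSet, f.coeff g = 0}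
  zero_mem' g _ := rfl
  add_mem' hf hf' g hg := by simp [hf g hg, hf' g hg]
  smul_mem' p f hf := by
    induction p using MvPolynomial.induction_on generalizing f with
    | C c =>
      intro g hg
      rw [C_smul]
      simp [hf g hg]
    | add p q hp hq =>
      intro g hg
      rw [add_smul]
      simp [hp f hf g hg, hq f hf g hg]
    | mul_X p i hp =>
      rw [mul_smul]
      refine hp _ fun g hg => ?_
      rw [X_smul]
      by_cases h : ∃ d, expo i + d = g
      · obtain ⟨d, rfl⟩ := h
        rw [AddMonoidAlgebra.coeff_single_mul_add, one_mul]
        exact hf d fun hd => hg (expo_add_mem_zeroSet i hd)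
      · push Not at h
        exact AddMonoidAlgebra.coeff_single_mul_of_forall_add_ne _ _ h

theorem single_mem_zeroSubmodule {g : ℤ × ℕ × ℕ} (hg : g ∈ zeroSet) (c : k) :
    (AddMonoidAlgebra.single g c : Laurent k) ∈ zeroSubmodule k := by
  intro g' hg'
  rw [AddMonoidAlgebra.coeff_single, Finsupp.single_apply, if_neg]
  rintro rfl
  exact hg' hg

variable (k) in
/-- The module of the elements of `A'₀` that are linear in the `x_i`. -/
abbrev LinPart : Type u := Laurent k ⧸ zeroSubmodule k

/-- `TrivSqZeroExt` multiplies using a left and a right action; here they coincide. -/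
instance : Module (Poly k)ᵐᵒᵖ (LinPart k) :=
  Module.compHom _ ((RingHom.id (Poly k)).fromOpposite mul_comm)

instance : IsCentralScalar (Poly k) (LinPart k) := ⟨fun _ _ => rfl⟩

variable (k) in
/-- The model `k[y, t, u] ⊕ M` of `A'₀`, with `M` of square zero. -/
abbrev Model : Type u := TrivSqZeroExt (Poly k) (LinPart k)

/-- The class of a monomial. -/
def mono (g : ℤ × ℕ × ℕ) : LinPart k := (zeroSubmodule k).mkQ (AddMonoidAlgebra.single g 1)

theorem X_pow_smul_mono (i : Fin 3) (n : ℕ) (g : ℤ × ℕ × ℕ) :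
    (MvPolynomial.X i ^ n : Poly k) • (mono g : LinPart k) = mono (n • expo i + g) := by
  rw [mono, ← map_smul, X_pow_smul_single, mono]

theorem mono_eq_zero {g : ℤ × ℕ × ℕ} (hg : g ∈ zeroSet) : (mono g : LinPart k) = 0 :=
  (Submodule.Quotient.mk_eq_zero _).mpr (single_mem_zeroSubmodule hg 1)

theorem inr_mul_inl_X_pow (i : Fin 3) (n : ℕ) (g : ℤ × ℕ × ℕ) :
    (TrivSqZeroExt.inr (mono g) : Model k) * TrivSqZeroExt.inl (MvPolynomial.X i) ^ n =
      TrivSqZeroExt.inr (mono (n • expo i + g)) := by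
  rw [mul_comm, ← X_pow_smul_mono, ← TrivSqZeroExt.inl_mul_inr, TrivSqZeroExt.inl_pow]

theorem exists_toModel : ∃ f : A₀ k →+* Model k,
    (∀ a, f (scalar k a) = TrivSqZeroExt.inl (MvPolynomial.C a)) ∧
    (∀ i : ℕ, f (xA k i) = TrivSqZeroExt.inr (mono (-i - 1, 0, 0))) ∧
    f (yA k) = TrivSqZeroExt.inl (MvPolynomial.X 0) ∧
    f (t k) = TrivSqZeroExt.inl (MvPolynomial.X 1) ∧
    f (u k) = TrivSqZeroExt.inl (MvPolynomial.X 2) := by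
  refine exists_ringHom ((TrivSqZeroExt.inlHom (Poly k) (LinPart k)).comp MvPolynomial.C) _ _ _ _
    ?_ (fun i => ?_) (fun i => ?_) (fun i => ?_)
  · rw [← pow_one (TrivSqZeroExt.inl _), inr_mul_inl_X_pow, mono_eq_zero, TrivSqZeroExt.inr_zero]
    simp [expo, zeroSet]
  · rw [← pow_one (TrivSqZeroExt.inl _), inr_mul_inl_X_pow]
    congr 2
    simp [expo]
    ring
  · rw [inr_mul_inl_X_pow, mono_eq_zero, TrivSqZeroExt.inr_zero]
    simp [expo, zeroSet]
    omega
  · rw [← pow_one (TrivSqZeroExt.inl (MvPolynomial.X 2)), inr_mul_inl_X_pow, inr_mul_inl_X_pow,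
      mono_eq_zero, TrivSqZeroExt.inr_zero]
    simp [expo, zeroSet]
    omega

variable (k) in
/-- The homomorphism from `A'₀` to its model. -/
def toModel : A₀ k →+* Model k := exists_toModel.choose

theorem toModel_scalar (a : k) : toModel k (scalar k a) = TrivSqZeroExt.inl (MvPolynomial.C a) :=
  exists_toModel.choose_spec.1 a

theorem toModel_xA (i : ℕ) : toModel k (xA k i) = TrivSqZeroExt.inr (mono (-i - 1, 0, 0)) :=
  exists_toModel.choose_spec.2.1 i

theorem toModel_yA : toModel k (yA k) = TrivSqZeroExt.inl (MvPolynomial.X 0) :=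
  exists_toModel.choose_spec.2.2.1

theorem toModel_t : toModel k (t k) = TrivSqZeroExt.inl (MvPolynomial.X 1) :=
  exists_toModel.choose_spec.2.2.2.1

theorem toModel_u : toModel k (u k) = TrivSqZeroExt.inl (MvPolynomial.X 2) :=
  exists_toModel.choose_spec.2.2.2.2

variable (k) in
/-- The homomorphism `k[y, t, u] → A'₀`. -/
def polyHom : Poly k →+* A₀ k := MvPolynomial.eval₂Hom (scalar k) ![yA k, t k, u k]

instance : Algebra (Poly k) (A₀ k) := (polyHom k).toAlgebra

variable (k) in
/-- The element of `A'₀` represented by a monomial. -/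
def monoA (g : ℤ × ℕ × ℕ) : A₀ k :=
  -- The value `0` for nonnegative powers of `y` reflects `x_0 y = 0`.
  if g.1 < 0 then xA k (-g.1 - 1).toNat * t k ^ g.2.1 * u k ^ g.2.2 else 0

theorem monoA_mul_monoA (g h : ℤ × ℕ × ℕ) : monoA k g * monoA k h = 0 := by
  unfold monoA
  split_ifs
  · calc _ = xA k (-g.1 - 1).toNat * xA k (-h.1 - 1).toNat *
        (t k ^ g.2.1 * u k ^ g.2.2 * t k ^ h.2.1 * u k ^ h.2.2) := by ring
      _ = 0 := by rw [xA_mul_xA, zero_mul]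
  all_goals simp

theorem monoA_expo_add (i : Fin 3) (g : ℤ × ℕ × ℕ) :
    monoA k (expo i + g) = ![yA k, t k, u k] i * monoA k g := by
  obtain ⟨j, a, b⟩ := g
  unfold monoA
  fin_cases i
  · by_cases hj : j < 0
    · obtain ⟨i, rfl⟩ : ∃ i : ℕ, j = -i - 1 := ⟨(-j - 1).toNat, by omega⟩
      have e : (-(-(i : ℤ) - 1) - 1).toNat = i := by omega
      rcases i with _ | i
      · simp only [e]
        simp only [expo, Fin.zero_eta, Matrix.cons_val_zero, Prod.mk_add_mk, zero_add]
        rw [if_neg (by simp), if_pos hj]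
        linear_combination -(t k ^ a * u k ^ b) * xA_zero_mul_yA k
      · have e' : (-(1 + (-((i + 1 : ℕ) : ℤ) - 1)) - 1).toNat = i := by omega
        have h1 : 1 + (-((i + 1 : ℕ) : ℤ) - 1) < 0 := by omega
        simp only [e, if_pos hj]
        simp only [expo, Fin.zero_eta, Matrix.cons_val_zero, Prod.mk_add_mk, zero_add, e', if_pos h1]
        rw [← xA_succ_mul_yA]
        ring
    · have h1 : ¬ 1 + j < 0 := by omega
      simp [expo, hj, h1]
  · simp only [expo, Fin.mk_one, Matrix.cons_val_one, Matrix.cons_val_zero, Prod.mk_add_mk, zero_add]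
    split_ifs <;> ring
  · simp only [expo, Fin.reduceFinMk, Matrix.cons_val, Prod.mk_add_mk, zero_add]
    split_ifs <;> ring

theorem monoA_eq_zero {g : ℤ × ℕ × ℕ} (hg : g ∈ zeroSet) : monoA k g = 0 := by
  obtain ⟨j, a, b⟩ := g
  unfold monoA
  split_ifs with hj
  · obtain ⟨i, rfl⟩ : ∃ i : ℕ, j = -i - 1 := ⟨(-j - 1).toNat, by simp at hj; omega⟩
    simp only [zeroSet, Set.mem_ofPred_eq] at hg hj
    have e : (-(-(i : ℤ) - 1) - 1).toNat = i := by omega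
    simp only [e]
    rcases hg with h | h | ⟨h, h'⟩
    · omega
    · obtain ⟨c, rfl⟩ := Nat.exists_eq_add_of_le (show i + 2 ≤ a by omega)
      rw [pow_add, ← mul_assoc (xA k i), xA_mul_t_pow, zero_mul, zero_mul]
    · obtain ⟨c, rfl⟩ := Nat.exists_eq_add_of_le (show i ≤ a by omega)
      obtain ⟨d, rfl⟩ := Nat.exists_eq_add_of_le h
      calc _ = xA k i * t k ^ i * u k * (t k ^ c * u k ^ d) := by ring
        _ = 0 := by rw [xA_mul_t_pow_mul_u, zero_mul]
  · rfl

/-- The additive map from Laurent polynomials to `A'₀`. -/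
def laurentAddHom : Laurent k →+ A₀ k :=
  (Finsupp.liftAddHom fun g => (AddMonoidHom.mulRight (monoA k g)).comp
    (scalar k).toAddMonoidHom).comp AddMonoidAlgebra.coeffAddEquiv.toAddMonoidHom

theorem laurentAddHom_single (g : ℤ × ℕ × ℕ) (c : k) :
    laurentAddHom (AddMonoidAlgebra.single g c) = scalar k c * monoA k g := by
  simp [laurentAddHom]

variable (k) in
/-- The linear map from Laurent polynomials to `A'₀`. -/
def laurentHom : Laurent k →ₗ[Poly k] A₀ k where
  __ := laurentAddHom
  map_smul' p f := by
    change laurentAddHom (p • f) = p • laurentAddHom f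
    induction p using MvPolynomial.induction_on generalizing f with
    | C c =>
      rw [C_smul]
      induction f using AddMonoidAlgebra.induction_linear with
      | zero => simp
      | add f g hf hg => rw [smul_add, map_add, hf, hg, map_add, smul_add]
      | single g d =>
        rw [AddMonoidAlgebra.smul_single, laurentAddHom_single, laurentAddHom_single, smul_eq_mul,
          map_mul, mul_assoc, Algebra.smul_def]
        congr 1
        exact (MvPolynomial.eval₂Hom_C _ _ c).symm
    | add p q hp hq => rw [add_smul, map_add, hp, hq, add_smul]
    | mul_X p i hp =>
      rw [mul_smul, hp, mul_smul]
      congr 1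
      induction f using AddMonoidAlgebra.induction_linear with
      | zero => simp
      | add f g hf hg => rw [smul_add, map_add, hf, hg, map_add, smul_add]
      | single g d =>
        rw [X_smul_single, laurentAddHom_single, laurentAddHom_single, monoA_expo_add,
          mul_left_comm, Algebra.smul_def]
        congr 1
        exact (MvPolynomial.eval₂Hom_X' _ _ i).symm

theorem laurentHom_single (g : ℤ × ℕ × ℕ) (c : k) :
    laurentHom k (AddMonoidAlgebra.single g c) = scalar k c * monoA k g :=
  laurentAddHom_single g c

theorem laurentHom_mul_laurentHom (f g : Laurent k) : laurentHom k f * laurentHom k g = 0 := by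
  induction f using AddMonoidAlgebra.induction_linear with
  | zero => simp
  | add f f' hf hf' => rw [map_add, add_mul, hf, hf', add_zero]
  | single a c =>
    induction g using AddMonoidAlgebra.induction_linear with
    | zero => simp
    | add f f' hf hf' => rw [map_add, mul_add, hf, hf', add_zero]
    | single b d =>
      rw [laurentHom_single, laurentHom_single, mul_mul_mul_comm, monoA_mul_monoA, mul_zero]

theorem laurentHom_eq_zero {f : Laurent k} (hf : f ∈ zeroSubmodule k) : laurentHom k f = 0 := by
  change laurentAddHom f = 0
  simp only [laurentAddHom, AddMonoidHom.comp_apply, Finsupp.liftAddHom_apply]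
  refine Finset.sum_eq_zero fun g hg => ?_
  have : g ∈ zeroSet := by
    by_contra h
    exact Finsupp.mem_support_iff.mp hg (hf g h)
  simp [monoA_eq_zero this]

/-- The inverse of `toModel`. -/
theorem exists_ofModel : ∃ f : Model k →+* A₀ k, f.comp (toModel k) = RingHom.id _ := by
  let g : LinPart k →ₗ[Poly k] A₀ k :=
    (zeroSubmodule k).liftQ (laurentHom k) fun f hf => laurentHom_eq_zero hf
  have hg : ∀ a b, g a * g b = 0 := fun a b => by
    obtain ⟨a, rfl⟩ := (zeroSubmodule k).mkQ_surjective a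
    obtain ⟨b, rfl⟩ := (zeroSubmodule k).mkQ_surjective b
    exact laurentHom_mul_laurentHom a b
  -- The square-zero condition needed here is `x_i x_j = 0`.
  let F : Model k →ₐ[Poly k] A₀ k := TrivSqZeroExt.lift (Algebra.ofId _ _) g hg
    (fun r x => by rw [map_smul, Algebra.smul_def]; rfl)
    (fun r x => by rw [op_smul_eq_smul, map_smul, Algebra.smul_def, mul_comm]; rfl)
  have hinl : ∀ p, F (TrivSqZeroExt.inl p) = polyHom k p := fun p =>
    TrivSqZeroExt.lift_apply_inl _ _ _ _ _ p
  refine ⟨F.toRingHom, ringHom_ext (fun c => ?_) (fun i => ?_) ?_ ?_ ?_⟩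
  · change F _ = _
    rw [toModel_scalar, hinl]
    simp [polyHom]
  · change F _ = _
    rw [toModel_xA]
    refine (TrivSqZeroExt.lift_apply_inr _ _ _ _ _ _).trans ?_
    refine (laurentHom_single _ _).trans ?_
    have e : (-(-(i : ℤ) - 1) - 1).toNat = i := by omega
    have e' : -(i : ℤ) - 1 < 0 := by omega
    simp [monoA, e']
  · change F _ = _
    rw [toModel_yA, hinl]
    simp [polyHom]
  · change F _ = _
    rw [toModel_t, hinl]
    simp [polyHom]
  · change F _ = _
    rw [toModel_u, hinl]
    simp [polyHom]

theorem toModel_injective : Function.Injective (toModel k) := by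
  obtain ⟨f, hf⟩ := exists_ofModel (k := k)
  exact Function.LeftInverse.injective (g := f) fun z => congr($hf z)

end NormalForm

/-! ### Torsion and ideal membership in the monomial model -/

section Torsion

variable {k : Type u} [Field k]

/-- The submodule is monomial, so it suffices to treat `y^(-i-1) t^a u^b` with `i ≥ 0`. If a power
of `u` kills it, then `a ≥ i` in every case, so `u` kills it by `x_i t^i u = 0` and `t²` by `x_i
t^(i+2) = 0`. -/
theorem smul_mem_of_X_two_pow_smul_mem {n : ℕ} {f : Laurent k}
    (hf : (MvPolynomial.X 2 ^ n : Poly k) • f ∈ zeroSubmodule k) :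
    (MvPolynomial.X 2 : Poly k) • f ∈ zeroSubmodule k ∧
      (MvPolynomial.X 1 ^ 2 : Poly k) • f ∈ zeroSubmodule k := by
  have hsupp : ∀ g ∈ f.coeff.support, n • expo 2 + g ∈ zeroSet := fun g hg => by
    by_contra h
    have := hf _ h
    rw [X_pow_smul, AddMonoidAlgebra.coeff_single_mul_add, one_mul] at this
    exact Finsupp.mem_support_iff.mp hg this
  have hsum : f = ∑ g ∈ f.coeff.support, AddMonoidAlgebra.single g (f.coeff g) :=
    (AddMonoidAlgebra.sum_coeff_single f).symm
  constructor
  · rw [hsum, Finset.smul_sum]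
    refine sum_mem fun g hg => ?_
    rw [X_smul_single]
    refine single_mem_zeroSubmodule ?_ _
    have := hsupp g hg
    simp [zeroSet, expo] at this ⊢
    omega
  · rw [hsum, Finset.smul_sum]
    refine sum_mem fun g hg => ?_
    rw [X_pow_smul_single]
    refine single_mem_zeroSubmodule ?_ _
    have := hsupp g hg
    simp [zeroSet, expo] at this ⊢
    omega

/-- The `u`-torsion of `A'₀` is killed by `u` and by `t²`. -/
theorem mul_eq_zero_of_u_pow_mul_eq_zero {n : ℕ} {z : A₀ k} (hz : u k ^ n * z = 0) :
    u k * z = 0 ∧ t k ^ 2 * z = 0 := by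
  have h := congr(toModel k $hz)
  rw [map_mul, map_pow, toModel_u, map_zero, TrivSqZeroExt.inl_pow] at h
  have h1 := congr(TrivSqZeroExt.fst $h)
  have h2 := congr(TrivSqZeroExt.snd $h)
  simp only [TrivSqZeroExt.fst_mul, TrivSqZeroExt.snd_mul, TrivSqZeroExt.fst_inl,
    TrivSqZeroExt.snd_inl, TrivSqZeroExt.fst_zero, TrivSqZeroExt.snd_zero, smul_zero,
    add_zero] at h1 h2
  have h1' : (toModel k z).fst = 0 := by
    -- The part free of the `x_i` lies in the domain `k[y, t, u]`, so it has no torsion.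
    refine (mul_eq_zero.mp h1).resolve_left (pow_ne_zero _ (MvPolynomial.X_ne_zero _))
  obtain ⟨f, hf⟩ := (zeroSubmodule k).mkQ_surjective (toModel k z).snd
  rw [← hf, ← map_smul] at h2
  obtain ⟨h3, h4⟩ := smul_mem_of_X_two_pow_smul_mem ((Submodule.Quotient.mk_eq_zero _).mp h2)
  constructor <;> apply toModel_injective
  · rw [map_mul, toModel_u, map_zero]
    ext1
    · simp [h1']
    · simp only [TrivSqZeroExt.snd_mul, TrivSqZeroExt.fst_inl,
        TrivSqZeroExt.snd_inl, TrivSqZeroExt.snd_zero, smul_zero, add_zero]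
      rw [← hf, ← map_smul]
      exact (Submodule.Quotient.mk_eq_zero _).mpr h3
  · rw [map_mul, map_pow, toModel_t, map_zero, TrivSqZeroExt.inl_pow]
    ext1
    · simp [h1']
    · simp only [TrivSqZeroExt.snd_mul, TrivSqZeroExt.fst_inl,
        TrivSqZeroExt.snd_inl, TrivSqZeroExt.snd_zero, smul_zero, add_zero]
      rw [← hf, ← map_smul]
      exact (Submodule.Quotient.mk_eq_zero _).mpr h4

/-- The monomial `y^(-i-1) t^(i+1)` is nonzero in the model, with too low a degree in `u` and in `t`
to occur in a multiple of `u` or of `t^(i+2)`. Comparing its coefficient on both sides gives `1 =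
0`. -/
theorem t_pow_mul_xA_notMem (i : ℕ) :
    t k ^ (i + 1) * xA k i ∉ Ideal.span {u k, t k ^ (i + 2)} := by
  intro h
  obtain ⟨a, b, hab⟩ := Ideal.mem_span_pair.mp h
  have h := congr(TrivSqZeroExt.snd (toModel k $hab))
  rw [mul_comm a, mul_comm b] at h
  simp only [map_add, map_mul, map_pow, toModel_u, toModel_t, toModel_xA] at h
  simp only [TrivSqZeroExt.inl_pow, TrivSqZeroExt.snd_add, TrivSqZeroExt.snd_mul,
    TrivSqZeroExt.fst_inl, TrivSqZeroExt.snd_inl, smul_zero, add_zero,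
    TrivSqZeroExt.snd_inr] at h
  obtain ⟨f, hf⟩ := (zeroSubmodule k).mkQ_surjective (toModel k a).snd
  obtain ⟨g, hg⟩ := (zeroSubmodule k).mkQ_surjective (toModel k b).snd
  rw [← hf, ← hg, X_pow_smul_mono, mono, ← map_smul, ← map_smul, ← map_add, ← sub_eq_zero,
    ← map_sub] at h
  have h' := (Submodule.Quotient.mk_eq_zero _).mp h ((i + 1) • expo 1 + (-(i : ℤ) - 1, 0, 0))
    (by simp [zeroSet, expo]; omega)
  rw [X_pow_smul, X_smul] at h'
  simp only [AddMonoidAlgebra.coeff_sub, AddMonoidAlgebra.coeff_add, Finsupp.sub_apply,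
    Finsupp.add_apply, AddMonoidAlgebra.coeff_single, Finsupp.single_eq_same] at h'
  rw [AddMonoidAlgebra.coeff_single_mul_of_forall_add_ne, 
    AddMonoidAlgebra.coeff_single_mul_of_forall_add_ne] at h'
  · simp at h'
  · rintro ⟨j, c, d⟩ hd
    simp [expo] at hd
    omega
  · rintro ⟨j, c, d⟩ hd
    simp [expo] at hd

end Torsion

end Example

/-! ### Passage from `A'₀` to an arbitrary henselization -/

namespace Example

variable {k : Type u} [Field k]

/-- The annihilator of `u` and `t²` in `A'₀`. -/
def annIdeal (k : Type u) [Field k] : Ideal (A₀ k) where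
  carrier := {z | u k * z = 0 ∧ t k ^ 2 * z = 0}
  zero_mem' := ⟨mul_zero _, mul_zero _⟩
  add_mem' h h' := ⟨by rw [mul_add, h.1, h'.1, add_zero], by rw [mul_add, h.2, h'.2, add_zero]⟩
  smul_mem' c z h := ⟨by rw [smul_eq_mul, mul_left_comm, h.1, mul_zero],
    by rw [smul_eq_mul, mul_left_comm, h.2, mul_zero]⟩

theorem u_mul_eq_zero_and_t_sq_mul_eq_zero {B : Type u} [CommRing B] [Algebra (A₀ k) B] {z : B}
    (hz : z ∈ (annIdeal k).map (algebraMap (A₀ k) B)) :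
    algebraMap (A₀ k) B (u k) * z = 0 ∧ algebraMap (A₀ k) B (t k) ^ 2 * z = 0 := by
  refine Submodule.span_induction ?_ ?_ ?_ ?_ hz
  · rintro _ ⟨z, hz, rfl⟩
    rw [← map_pow, ← map_mul, ← map_mul, hz.1, hz.2]
    simp
  · simp
  · intro x y _ _ hx hy
    rw [mul_add, mul_add, hx.1, hx.2, hy.1, hy.2]
    simp
  · intro c x _ hx
    rw [smul_eq_mul, mul_left_comm, hx.1, mul_left_comm, hx.2]
    simp

theorem map_I₀ {B : Type*} [CommRing B] (φ : A₀ k →+* B) :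
    (I₀ k).map φ = Ideal.span {φ (t k), φ (u k)} := by
  rw [I₀, Ideal.map_span, Set.image_pair]

theorem hasBoundedTorsion_map {A' : Type u} [CommRing A'] {J : Ideal A'} {φ : A₀ k →+* A'}
    (h : IsHenselization (I₀ k) J φ) : ((I₀ k).map φ).HasBoundedTorsion := by
  have hH := Henselization.isHenselization (I₀ k)
  obtain ⟨ψ, ⟨hψJ, hψ⟩, -⟩ := h.existsUnique_lift _ _ hH.isHenselianPair _ hH.isPairMorphism
  obtain ⟨θ, ⟨hθJ, hθ⟩, -⟩ := hH.existsUnique_lift _ _ h.isHenselianPair _ h.isPairMorphism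
  have hθψ : θ.comp ψ = RingHom.id A' := by
    refine (h.existsUnique_lift _ J h.isHenselianPair φ h.isPairMorphism).unique ⟨?_, ?_⟩ ⟨?_, ?_⟩
    · rw [IsPairMorphism] at hθJ hψJ ⊢
      rw [← Ideal.comap_comap, hθJ, hψJ]
    · rw [RingHom.comp_assoc, hψ, hθ]
    · exact Ideal.comap_id J
    · exact RingHom.id_comp φ
  -- The exponent `2` suffices because `t²`, `tu` and `u²` all kill what `u` and `t²` kill.
  refine ⟨2, two_pos, ?_⟩
  rw [eq_bot_iff, Ideal.mul_le]
  intro r hr x hx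
  have hxu : ∃ n, φ (u k) ^ n * x = 0 := by
    have hu : φ (u k) ∈ (I₀ k).map φ :=
      Ideal.mem_map_of_mem φ (Ideal.subset_span (by simp))
    rw [Ideal.torsionElements, Submodule.mem_iInf] at hx
    have := hx (φ (u k))
    rw [Submodule.mem_iInf] at this
    obtain ⟨⟨_, n, rfl⟩, hn⟩ := this hu
    exact ⟨n, hn⟩
  obtain ⟨n, hn⟩ := hxu
  -- The flatness argument is available in the constructed henselization, so the torsion element is
  -- moved there by `ψ` and brought back by `θ`.
  have hmem : ψ x ∈ (annIdeal k).map (algebraMap (A₀ k) (Henselization (I₀ k))) := by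
    refine Henselization.mem_map_of_mul_eq_zero (a := u k ^ n)
      (fun z hz => mul_eq_zero_of_u_pow_mul_eq_zero hz) ?_
    have := congr(ψ $hn)
    rw [map_mul, map_pow, map_zero] at this
    rw [map_pow, ← hψ]
    exact this
  have hback : ∀ z, θ (ψ z) = z := fun z => congr($hθψ z)
  obtain ⟨h1, h2⟩ := u_mul_eq_zero_and_t_sq_mul_eq_zero hmem
  have hθ' : ∀ a, θ (algebraMap _ _ a) = φ a := fun a => congr($hθ a)
  have h1 := congr(θ $h1)
  have h2 := congr(θ $h2)
  rw [map_mul, hθ', hback, map_zero] at h1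
  rw [map_mul, map_pow, hθ', hback, map_zero] at h2
  rw [Submodule.mem_bot]
  rw [map_I₀, pow_two] at hr
  refine Submodule.mul_induction_on hr (fun a ha b hb => ?_) (fun a b ha hb => ?_)
  · obtain ⟨c, d, rfl⟩ := Ideal.mem_span_pair.mp ha
    obtain ⟨c', d', rfl⟩ := Ideal.mem_span_pair.mp hb
    linear_combination (c * c') * h2 + (c * d' * φ (t k) + d * c' * φ (t k) + d * d' * φ (u k)) * h1
  · rw [add_mul, ha, hb, add_zero]

/-- The image of `I₀` is generated by the nilpotent image of `t`, so it gives a henselian pair.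
Surjectivity and the kernel condition make `π` a morphism of pairs. -/
theorem exists_comp_eq_of_isHenselization {A' : Type u} [CommRing A'] {J : Ideal A'}
    {φ : A₀ k →+* A'} (h : IsHenselization (I₀ k) J φ) {B : Type u} [CommRing B] (π : A₀ k →+* B)
    (hπ : Function.Surjective π) (hker : ∀ a, π a = 0 → a ∈ I₀ k) (hu : π (u k) = 0) {n : ℕ}
    (ht : π (t k ^ n) = 0) : ∃ ρ : A' →+* B, ρ.comp φ = π := by
  have hK : IsNilpotent ((I₀ k).map π) := by
    refine ⟨n, ?_⟩
    rw [map_I₀, hu, Ideal.span_pair_zero, Ideal.span_singleton_pow, ← map_pow, ht]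
    simp
  have hpair : IsPairMorphism (I₀ k) ((I₀ k).map π) π := by
    rw [IsPairMorphism, Ideal.comap_map_of_surjective _ hπ]
    exact sup_eq_left.mpr hker
  obtain ⟨ρ, ⟨-, hρ⟩, -⟩ :=
    h.existsUnique_lift _ _ (isHenselianPair_of_isNilpotent hK) π hpair
  exact ⟨ρ, hρ⟩

theorem exists_quotient_ne_zero {A : Type u} [CommRing A] {t u w : A} {n : ℕ}
    (hw : w ∉ Ideal.span {u, t ^ (n + 1)}) :
    ∃ (B : Type u) (_ : CommRing B) (π : A →+* B), Function.Surjective π ∧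
      (∀ a, π a = 0 → a ∈ Ideal.span {t, u}) ∧ π u = 0 ∧ π (t ^ (n + 1)) = 0 ∧ π w ≠ 0 := by
  have hle : Ideal.span {u, t ^ (n + 1)} ≤ Ideal.span {t, u} := by
    refine Ideal.span_le.mpr ?_
    rintro x (rfl | rfl)
    · exact Ideal.subset_span (by simp)
    · exact Ideal.pow_mem_of_mem _ (Ideal.subset_span (by simp)) _ n.succ_pos
  exact ⟨_, inferInstance, Ideal.Quotient.mk (Ideal.span {u, t ^ (n + 1)}),
    Ideal.Quotient.mk_surjective, fun a ha => hle (Ideal.Quotient.eq_zero_iff_mem.mp ha),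
    Ideal.Quotient.eq_zero_iff_mem.mpr (Ideal.subset_span (by simp)),
    Ideal.Quotient.eq_zero_iff_mem.mpr (Ideal.subset_span (by simp)),
    fun h => hw (Ideal.Quotient.eq_zero_iff_mem.mp h)⟩

theorem not_isWeaklyProregular_map {A' : Type u} [CommRing A'] {J : Ideal A'} {φ : A₀ k →+* A'}
    (h : IsHenselization (I₀ k) J φ) : ¬ ((I₀ k).map φ).IsWeaklyProregular := by
  intro hw
  rw [map_I₀] at hw
  obtain ⟨M, hM, hf⟩ := hw.exists_pow_mul_mem
  -- With `M = i + 1` the critical element is `x_i`, because `t^(i+2) x_i = 0`.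
  obtain ⟨i, rfl⟩ := Nat.exists_eq_succ_of_ne_zero hM.ne'
  have hmem : φ (t k ^ (i + 1) * xA k i) ∈ Ideal.span {φ (u k)} := by
    rw [map_mul, map_pow]
    refine hf _ ?_
    rw [← map_pow, ← map_mul, mul_comm, xA_mul_t_pow, map_zero]
  obtain ⟨B, _, π, hπ, hker, hu, ht, hne⟩ := exists_quotient_ne_zero (t_pow_mul_xA_notMem (k := k) i)
  obtain ⟨ρ, hρ⟩ := exists_comp_eq_of_isHenselization h π hπ hker hu ht
  obtain ⟨c, hc⟩ := Ideal.mem_span_singleton'.mp hmem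
  have hρ' : ∀ a, ρ (φ a) = π a := fun a => congr($hρ a)
  have h0 := congr(ρ $hc)
  rw [map_mul, hρ', hρ', hu, mul_zero] at h0
  exact hne h0.symm

end Example

end

theorem claim4p3 (k : Type u) [Field k] :
    (∃ (A' : Type u) (_ : CommRing A') (J : Ideal A') (φ : Example.A₀ k →+* A'),
      IsHenselization (Example.I₀ k) J φ) ∧
    ∀ (A' : Type u) [CommRing A'] (J : Ideal A') (φ : Example.A₀ k →+* A'),
      IsHenselization (Example.I₀ k) J φ →
        ((Example.I₀ k).map φ).HasBoundedTorsion ∧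
        ¬ ((Example.I₀ k).map φ).IsWeaklyProregular :=
  ⟨⟨_, _, _, _, Henselization.isHenselization (Example.I₀ k)⟩, fun _ _ _ _ h =>
    ⟨Example.hasBoundedTorsion_map h, Example.not_isWeaklyProregular_map h⟩⟩
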